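/- For $n \ge 1$ let $\mathcal{M}(n,2)$ be the set of $n\times n$ matrices with non-negative integer entries all of whose row sums and column sums equal $2$. For $A=(a_{ij}) \in \mathcal{M}(n,2)$, a component of $A$ is a pair $(S,T)$ of non-empty subsets of $\{1,\dots,n\}$ of equal cardinality such that every row sum and every column sum of the submatrix $(a_{ij})_{i\in S,\,j\in T}$ equals $2$; it is irreducible if every component $(S',T')$ with $S'\subseteq S$ and $T'\subseteq T$ equals $(S,T)$. Let $L(A)$ be the largest size $|S|=|T|$ of an irreducible component $(S,T)$ of $A$. Write $E_1(u)=\int_u^\infty \frac{e^{-v}}{v}\,dv$ for $u>0$. Theorem. For each $n$ let $\mathcal{A}_n$ be a random matrix distributed uniformly on $\mathcal{M}(n,2)$. Then, as $n\to\infty$, $L(\mathcal{A}_n)/n$ converges weakly to a probability measure $\mathcal{L}$ on $(0,1)$ (convergence in distribution of real random variables). The measure $\mathcal{L}$ is the unique probability measure on $(0,1)$ whose moments are $$\int_{(0,1)} u^m \, d\mathcal{L}(u) = \frac{\sqrt{\pi}}{2\,\Gamma(m+\tfrac12)} \int_0^\infty \exp\!\left(-\tfrac12 E_1(u)-u\right)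 u^{m-1}\,du, \qquad m\ge 1,$$ where the integrals on the right-hand side are finite. -/

import Mathlib

open MeasureTheory ProbabilityTheory Filter Topology Set

/-- The set `M(n, r)` of magical squares of dimension `n` and line sum `r`: the `n × n` matrices with
entries in `ℕ` all of whose row sums and column sums are equal to `r`. -/
def magicalSquares (n r : ℕ) : Set (Matrix (Fin n) (Fin n) ℕ) :=
  {A | (∀ i, ∑ j, A i j = r) ∧ ∀ j, ∑ i, A i j = r}

/-- The countable set of `n × n` matrices over `ℕ` carries the discrete σ-algebra. -/
instance instMeasurableSpaceNatMatrix (n : ℕ) : MeasurableSpace (Matrix (Fin n) (Fin n) ℕ) := ⊤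

/-- `(S, T)` is a component of `A` (for the line sum `r`): `S` and `T` are non-empty sets of rows and
of columns of the same cardinality, and the submatrix `A(S, T)` has all row and column sums `r`. -/
structure IsComponent {n : ℕ} (r : ℕ) (A : Matrix (Fin n) (Fin n) ℕ) (S T : Finset (Fin n)) :
    Prop where
  rows_nonempty : S.Nonempty
  cols_nonempty : T.Nonempty
  card_eq : S.card = T.card
  row_sum : ∀ i ∈ S, ∑ j ∈ T, A i j = r
  col_sum : ∀ j ∈ T, ∑ i ∈ S, A i j = r

/-- A component is irreducible if it contains no other component. -/
def IsIrreducibleComponent {n : ℕ} (r : ℕ) (A : Matrix (Fin n) (Fin n) ℕ)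
    (S T : Finset (Fin n)) : Prop :=
  IsComponent r A S T ∧
    ∀ S' T' : Finset (Fin n), IsComponent r A S' T' → S' ⊆ S → T' ⊆ T → S' = S ∧ T' = T

/-- `χ_k(A)`: the number of irreducible components `(S, T)` of `A` of size `k = |S| = |T|`. -/
noncomputable def componentCount {n : ℕ} (r : ℕ) (A : Matrix (Fin n) (Fin n) ℕ) (k : ℕ) : ℕ :=
  Set.ncard {p : Finset (Fin n) × Finset (Fin n) |
    IsIrreducibleComponent r A p.1 p.2 ∧ p.1.card = k}

/-- `L(A) = max {k ≥ 1 : χ_k(A) > 0}`, the size of the largest irreducible component of `A`.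
The set is finite, as no component has more than `n` rows. -/
noncomputable def largestComponent {n : ℕ} (r : ℕ) (A : Matrix (Fin n) (Fin n) ℕ) : ℕ :=
  sSup {k : ℕ | 1 ≤ k ∧ 0 < componentCount r A k}

/-- The exponential integral `E₁(u) = ∫_u^∞ e^{-v} / v dv`, for `u > 0`. -/
noncomputable def expIntegralE1 (u : ℝ) : ℝ :=
  ∫ v in Ioi u, Real.exp (-v) / v

/-- The integral that defines `E₁(u)` converges for every `u > 0`. -/
theorem integrableOn_expIntegralE1 {u : ℝ} (hu : 0 < u) :
    IntegrableOn (fun v : ℝ => Real.exp (-v) / v) (Ioi u) := by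
  have h : IntegrableOn (fun v : ℝ => Real.exp (-v) / u) (Ioi u) :=
    (integrableOn_exp_neg_Ioi u).div_const u
  refine Integrable.mono' h ?_ ?_
  · exact (by fun_prop : Measurable fun v : ℝ => Real.exp (-v) / v).aestronglyMeasurable
  · filter_upwards [ae_restrict_mem measurableSet_Ioi] with v hv
    have hv' : u < v := hv
    have hv0 : 0 < v := hu.trans hv'
    rw [Real.norm_of_nonneg (by positivity)]
    gcongr

/-- The integrand `exp (-E₁(u)/2 - u) u^{m-1}`, used for `u > 0` and `m ≥ 1`. -/
noncomputable def momentIntegrand (m : ℕ) (u : ℝ) : ℝ :=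
  Real.exp (-(1 / 2) * expIntegralE1 u - u) * u ^ (m - 1)

/-- `𝓛` is concentrated on the open interval `(0, 1)`, and for every `m ≥ 1` its `m`-th moment is
`√π / (2 Γ(m + 1/2)) ∫_0^∞ exp (-E₁(u)/2 - u) u^{m-1} du`. -/
def IsLargestComponentLaw (𝓛 : ProbabilityMeasure ℝ) : Prop :=
  (𝓛 : Measure ℝ) (Ioo 0 1) = 1 ∧
    ∀ m : ℕ, 1 ≤ m →
      ∫ u in Ioo (0 : ℝ) 1, u ^ m ∂(𝓛 : Measure ℝ) =
        Real.sqrt Real.pi / (2 * Real.Gamma ((m : ℝ) + 1 / 2)) *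
          ∫ u in Ioi (0 : ℝ), momentIntegrand m u

/-! Counting. A matrix with all line sums 2 is the incidence matrix of a bipartite multigraph, and
its irreducible components are the connected components of that graph. Removing the component
through a fixed row gives a recursion (`card_boundedSquares_eq_sum`). An irreducible block is a sum
of two permutation matrices whose quotient is a full cycle, so there are j! (j-1)! / 2 of them for
size j > 1, and one for j = 1 (`card_irreducibleSquares`). Hence the squares of dimension n with all
components of size at most k number n!² q_k(n), where ∑ q_k(n) xⁿ = exp(∑_{j ≤ k} c_j x^j), c_1 = 1
and c_j = 1/(2j) for j > 1 (`card_boundedSquares`, `hasSum_expCoeff`). Write q for q_k without the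
bound; its generating function is Q(x) = e^{x/2} (1-x)^{-1/2}. The probability of L ≤ k is
q_k(n)/q(n).

Moments. Let M_m(n) be the m-th moment of L (`momentSeq`). Exchanging sums, ∑ q(n) M_m(n) e^{-sn} =
Q(e^{-s}) ∑_k ((k+1)^m - k^m)(1 - exp(-t_k(s))), where t_k(s) (`tailLog`) is close to E₁(sk)/2. As s
→ 0 the sum over k is a Riemann sum for s^{-m} ∫ m u^{m-1} (1 - exp(-E₁(u)/2)) du, and integration
by parts turns that integral into half of the one in the statement (`tendsto_laplace_momentSeq`,
`integral_tailIntegrand`).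

Tauberian step. The Laplace asymptotics only control averages over n. They yield M_m(n)/n^m itself
because q_k(n)/q(n) decreases in n (`expCoeff_ratio_succ_le`), so that M_m is monotone; Karamata's
method then applies (`tendsto_div_pow_of_laplace`). Since Q(e^{-s}) ~ e^{1/2} s^{-1/2}, the Gamma
factors are Γ(m+1/2) and Γ(1/2) = √π.

The limit law. Probability measures on [0,1] form a compact space, and a cluster point of the laws
of L/n has the limiting moments. It has no atom at 0 because L < εn has probability at most 2ε, and
none at 1 because the limiting moments tend to 0. Uniqueness and weak convergence follow from
Weierstrass approximation (`tendsto_of_tendsto_moments`). -/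

/-- `A` is supported in `U × V`, with row sums `2` on `U` and column sums `2` on `V`. -/
structure IsSquareOn {n : ℕ} (U V : Finset (Fin n)) (A : Matrix (Fin n) (Fin n) ℕ) : Prop where
  supp : ∀ i j, A i j ≠ 0 → i ∈ U ∧ j ∈ V
  row_sum : ∀ i ∈ U, ∑ j ∈ V, A i j = 2
  col_sum : ∀ j ∈ V, ∑ i ∈ U, A i j = 2

/-! ### Components as unions of connected components of a bipartite graph -/

section Blocks

variable {n : ℕ} {A B : Matrix (Fin n) (Fin n) ℕ} {S T S' T' U V : Finset (Fin n)}

theorem card_eq_of_sums_eq_two (hr : ∀ i ∈ S, ∑ j ∈ T, A i j = 2)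
    (hc : ∀ j ∈ T, ∑ i ∈ S, A i j = 2) : S.card = T.card := by
  have h1 : ∑ i ∈ S, ∑ j ∈ T, A i j = S.card * 2 := by
    rw [Finset.sum_congr rfl hr, Finset.sum_const, smul_eq_mul]
  have h2 : ∑ i ∈ S, ∑ j ∈ T, A i j = T.card * 2 := by
    refine (Finset.sum_comm (f := fun i j => A i j)).trans ?_
    rw [Finset.sum_congr rfl hc, Finset.sum_const, smul_eq_mul]
  omega

theorem sum_subset_eq_sum_iff {ι : Type*} [DecidableEq ι] {s t : Finset ι} (h : s ⊆ t) (f : ι → ℕ) :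
    ∑ i ∈ s, f i = ∑ i ∈ t, f i ↔ ∀ i ∈ t, f i ≠ 0 → i ∈ s := by
  rw [← Finset.sum_sdiff h]
  constructor
  · intro h0 i hi hne
    by_contra his
    have : ∑ i ∈ t \ s, f i = 0 := by omega
    exact hne ((Finset.sum_eq_zero_iff.mp this) i (Finset.mem_sdiff.mpr ⟨hi, his⟩))
  · intro h0
    have : ∑ i ∈ t \ s, f i = 0 := Finset.sum_eq_zero fun i hi => by
      rw [Finset.mem_sdiff] at hi
      by_contra hne
      exact hi.2 (h0 i hi.1 hne)
    omega

/-- A full row or column already sums to 2, so a subsum equals 2 exactly when it misses no non-zero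
entry. Components thus become sets closed under adjacency, a condition visibly stable under
intersection and difference; equality of cardinalities comes for free by double counting. -/
theorem isComponent_iff_of_subset (hr : ∀ i ∈ U, ∑ j ∈ V, A i j = 2)
    (hc : ∀ j ∈ V, ∑ i ∈ U, A i j = 2) (hS : S ⊆ U) (hT : T ⊆ V) :
    IsComponent 2 A S T ↔
      S.Nonempty ∧ ∀ i ∈ U, ∀ j ∈ V, A i j ≠ 0 → (i ∈ S ↔ j ∈ T) := by
  constructor
  · intro h
    refine ⟨h.rows_nonempty, fun i hi j hj hij => ⟨fun hiS => ?_, fun hjT => ?_⟩⟩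
    · exact (sum_subset_eq_sum_iff hT (A i)).mp ((h.row_sum i hiS).trans (hr i hi).symm) j hj hij
    · exact (sum_subset_eq_sum_iff hS (fun i => A i j)).mp
        ((h.col_sum j hjT).trans (hc j hj).symm) i hi hij
  · rintro ⟨hne, h⟩
    have hr' : ∀ i ∈ S, ∑ j ∈ T, A i j = 2 := fun i hi =>
      ((sum_subset_eq_sum_iff hT (A i)).mpr
        fun j hj hij => (h i (hS hi) j hj hij).mp hi).trans (hr i (hS hi))
    have hc' : ∀ j ∈ T, ∑ i ∈ S, A i j = 2 := fun j hj =>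
      ((sum_subset_eq_sum_iff hS (fun i => A i j)).mpr
        fun i hi hij => (h i hi j (hT hj) hij).mpr hj).trans (hc j (hT hj))
    have hcard := card_eq_of_sums_eq_two hr' hc'
    refine ⟨hne, ?_, hcard, hr', hc'⟩
    rw [← Finset.card_pos, ← hcard]
    exact hne.card_pos

theorem IsComponent.congr {r : ℕ} (h : IsComponent r A S T) (hAB : ∀ i ∈ S, ∀ j ∈ T, A i j = B i j) :
    IsComponent r B S T where
  rows_nonempty := h.rows_nonempty
  cols_nonempty := h.cols_nonempty
  card_eq := h.card_eq
  row_sum i hi := by rw [← h.row_sum i hi]; exact Finset.sum_congr rfl fun j hj => (hAB i hi j hj).symm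
  col_sum j hj := by rw [← h.col_sum j hj]; exact Finset.sum_congr rfl fun i hi => (hAB i hi j hj).symm

theorem IsIrreducibleComponent.congr {r : ℕ} (h : IsIrreducibleComponent r A S T)
    (hAB : ∀ i ∈ S, ∀ j ∈ T, A i j = B i j) : IsIrreducibleComponent r B S T :=
  ⟨h.1.congr hAB, fun S' T' h' hS hT =>
    h.2 S' T' (h'.congr fun i hi j hj => (hAB i (hS hi) j (hT hj)).symm) hS hT⟩

theorem IsSquareOn.subset_of_isComponent (h : IsSquareOn U V A) (hc : IsComponent 2 A S T) :
    S ⊆ U ∧ T ⊆ V := by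
  constructor
  · intro i hi
    have : ∑ j ∈ T, A i j ≠ 0 := by rw [hc.row_sum i hi]; decide
    obtain ⟨j, -, hj⟩ := Finset.exists_ne_zero_of_sum_ne_zero this
    exact (h.supp i j hj).1
  · intro j hj
    have : ∑ i ∈ S, A i j ≠ 0 := by rw [hc.col_sum j hj]; decide
    obtain ⟨i, -, hi⟩ := Finset.exists_ne_zero_of_sum_ne_zero this
    exact (h.supp i j hi).2

theorem IsSquareOn.isComponent_iff (h : IsSquareOn U V A) (hS : S ⊆ U) (hT : T ⊆ V) :
    IsComponent 2 A S T ↔ S.Nonempty ∧ ∀ i j, A i j ≠ 0 → (i ∈ S ↔ j ∈ T) := by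
  rw [isComponent_iff_of_subset h.row_sum h.col_sum hS hT]
  exact and_congr_right fun _ => ⟨fun H i j hij => H i (h.supp i j hij).1 j (h.supp i j hij).2 hij,
    fun H i _ j _ hij => H i j hij⟩

theorem IsSquareOn.isComponent_self (h : IsSquareOn U V A) (hU : U.Nonempty) :
    IsComponent 2 A U V :=
  (h.isComponent_iff subset_rfl subset_rfl).mpr
    ⟨hU, fun i j hij => by simp [(h.supp i j hij).1, (h.supp i j hij).2]⟩

theorem IsSquareOn.isComponent_inter (h : IsSquareOn U V A) (h1 : IsComponent 2 A S T)
    (h2 : IsComponent 2 A S' T') (hne : (S ∩ S').Nonempty) :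
    IsComponent 2 A (S ∩ S') (T ∩ T') := by
  obtain ⟨hS, hT⟩ := h.subset_of_isComponent h1
  obtain ⟨hS', hT'⟩ := h.subset_of_isComponent h2
  rw [h.isComponent_iff (Finset.inter_subset_left.trans hS) (Finset.inter_subset_left.trans hT)]
  refine ⟨hne, fun i j hij => ?_⟩
  rw [Finset.mem_inter, Finset.mem_inter, ((h.isComponent_iff hS hT).mp h1).2 i j hij,
    ((h.isComponent_iff hS' hT').mp h2).2 i j hij]

theorem IsSquareOn.isComponent_sdiff (h : IsSquareOn U V A) (h1 : IsComponent 2 A S T)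
    (h2 : IsComponent 2 A S' T') (hne : (S \ S').Nonempty) :
    IsComponent 2 A (S \ S') (T \ T') := by
  obtain ⟨hS, hT⟩ := h.subset_of_isComponent h1
  obtain ⟨hS', hT'⟩ := h.subset_of_isComponent h2
  rw [h.isComponent_iff (Finset.sdiff_subset.trans hS) (Finset.sdiff_subset.trans hT)]
  refine ⟨hne, fun i j hij => ?_⟩
  rw [Finset.mem_sdiff, Finset.mem_sdiff, ((h.isComponent_iff hS hT).mp h1).2 i j hij,
    ((h.isComponent_iff hS' hT').mp h2).2 i j hij]

theorem IsSquareOn.irreducible_subset (h : IsSquareOn U V A) (h1 : IsIrreducibleComponent 2 A S T)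
    (h2 : IsComponent 2 A S' T') (hne : (S ∩ S').Nonempty) : S ⊆ S' ∧ T ⊆ T' := by
  obtain ⟨e1, e2⟩ := h1.2 _ _ (h.isComponent_inter h1.1 h2 hne) Finset.inter_subset_left
    Finset.inter_subset_left
  exact ⟨Finset.inter_eq_left.mp e1, Finset.inter_eq_left.mp e2⟩

theorem IsSquareOn.disjoint_cols (h : IsSquareOn U V A) (h1 : IsComponent 2 A S T)
    (h2 : IsComponent 2 A S' T') (hd : Disjoint S S') : Disjoint T T' := by
  obtain ⟨hS, hT⟩ := h.subset_of_isComponent h1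
  obtain ⟨hS', hT'⟩ := h.subset_of_isComponent h2
  rw [Finset.disjoint_left]
  intro j hj hj'
  have : ∑ i ∈ S, A i j ≠ 0 := by rw [h1.col_sum j hj]; decide
  obtain ⟨i, hi, hij⟩ := Finset.exists_ne_zero_of_sum_ne_zero this
  exact Finset.disjoint_left.mp hd hi ((((h.isComponent_iff hS' hT').mp h2).2 i j hij).mpr hj')

theorem IsSquareOn.irreducible_unique (h : IsSquareOn U V A) (h1 : IsIrreducibleComponent 2 A S T)
    (h2 : IsIrreducibleComponent 2 A S' T') {u : Fin n} (hu : u ∈ S) (hu' : u ∈ S') :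
    S = S' ∧ T = T' := by
  obtain ⟨a, b⟩ := h.irreducible_subset h1 h2.1 ⟨u, Finset.mem_inter.mpr ⟨hu, hu'⟩⟩
  obtain ⟨c, d⟩ := h.irreducible_subset h2 h1.1 ⟨u, Finset.mem_inter.mpr ⟨hu', hu⟩⟩
  exact ⟨a.antisymm c, b.antisymm d⟩

/-- A component of least size through `u` works: a component strictly inside it either contains `u`,
against minimality, or can be subtracted to leave a smaller component that does. -/
theorem IsSquareOn.exists_irreducible (h : IsSquareOn U V A) {u : Fin n} (hu : u ∈ U) :
    ∃ S T, IsIrreducibleComponent 2 A S T ∧ u ∈ S := by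
  classical
  let F : Finset (Finset (Fin n) × Finset (Fin n)) :=
    Finset.univ.filter fun p => IsComponent 2 A p.1 p.2 ∧ u ∈ p.1
  have hF : F.Nonempty := ⟨(U, V), by simp [F, h.isComponent_self ⟨u, hu⟩, hu]⟩
  obtain ⟨⟨S, T⟩, hp, hmin⟩ := Finset.exists_min_image F (fun p => p.1.card) hF
  simp only [F, Finset.mem_filter, Finset.mem_univ, true_and] at hp hmin
  refine ⟨S, T, ⟨hp.1, fun S' T' h' hS hT => ?_⟩, hp.2⟩
  by_cases huS : u ∈ S'
  · have e1 : S' = S := Finset.eq_of_subset_of_card_le hS (hmin (S', T') ⟨h', huS⟩)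
    refine ⟨e1, Finset.eq_of_subset_of_card_le hT ?_⟩
    rw [← hp.1.card_eq, ← h'.card_eq, e1]
  · exfalso
    have h3 := h.isComponent_sdiff hp.1 h' ⟨u, Finset.mem_sdiff.mpr ⟨hp.2, huS⟩⟩
    have h4 := hmin (S \ S', T \ T') ⟨h3, Finset.mem_sdiff.mpr ⟨hp.2, huS⟩⟩
    have h5 := Finset.card_sdiff_add_card_eq_card hS
    have h6 := h'.rows_nonempty.card_pos
    simp only at h4
    omega

end Blocks

/-! ### Splitting off the irreducible component of a given row -/

section Recursion

theorem IsSquareOn.le_two {n : ℕ} {A : Matrix (Fin n) (Fin n) ℕ} {U V : Finset (Fin n)}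
    (h : IsSquareOn U V A) (i j : Fin n) : A i j ≤ 2 := by
  by_cases hij : A i j = 0
  · omega
  · obtain ⟨hi, hj⟩ := h.supp i j hij
    rw [← h.row_sum i hi]
    exact Finset.single_le_sum (f := A i) (fun _ _ => Nat.zero_le _) hj

theorem finite_isSquareOn {n : ℕ} (U V : Finset (Fin n)) :
    {A : Matrix (Fin n) (Fin n) ℕ | IsSquareOn U V A}.Finite := by
  refine Set.Finite.subset (s := {A : Matrix (Fin n) (Fin n) ℕ | ∀ i, A i ∈ {v | ∀ j, v j ∈ Iic 2}})
    ?_ fun A h i j => h.le_two i j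
  exact Set.Finite.pi' fun _ => Set.Finite.pi' fun _ => Set.finite_Iic 2

/-- The matrices on the block `U × V` with line sums `2` whose irreducible components all have size at
most `k`. -/
noncomputable def boundedSquares {n : ℕ} (k : ℕ) (U V : Finset (Fin n)) :
    Finset (Matrix (Fin n) (Fin n) ℕ) :=
  Set.Finite.toFinset (s := {A | IsSquareOn U V A ∧
      ∀ S T, IsIrreducibleComponent 2 A S T → S.card ≤ k})
    ((finite_isSquareOn U V).subset fun _ h => h.1)

/-- The matrices supported in `S × T` for which `(S, T)` is an irreducible component. -/
noncomputable def irreducibleSquares {n : ℕ} (S T : Finset (Fin n)) :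
    Finset (Matrix (Fin n) (Fin n) ℕ) :=
  Set.Finite.toFinset (s := {A | IsSquareOn S T A ∧ IsIrreducibleComponent 2 A S T})
    ((finite_isSquareOn S T).subset fun _ h => h.1)

variable {n : ℕ} {A B C : Matrix (Fin n) (Fin n) ℕ} {S T S' T' U V : Finset (Fin n)} {k : ℕ}

theorem mem_boundedSquares : A ∈ boundedSquares k U V ↔
    IsSquareOn U V A ∧ ∀ S T, IsIrreducibleComponent 2 A S T → S.card ≤ k :=
  Set.Finite.mem_toFinset _

theorem mem_irreducibleSquares : A ∈ irreducibleSquares S T ↔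
    IsSquareOn S T A ∧ IsIrreducibleComponent 2 A S T :=
  Set.Finite.mem_toFinset _

/-- The matrix `A` with the entries outside the block `S × T` replaced by `0`. -/
def blockRestrict (A : Matrix (Fin n) (Fin n) ℕ) (S T : Finset (Fin n)) : Matrix (Fin n) (Fin n) ℕ :=
  fun i j => if i ∈ S ∧ j ∈ T then A i j else 0

theorem blockRestrict_apply_of_mem {i j : Fin n} (hi : i ∈ S) (hj : j ∈ T) :
    blockRestrict A S T i j = A i j := if_pos ⟨hi, hj⟩

theorem isSquareOn_blockRestrict (hr : ∀ i ∈ S, ∑ j ∈ T, A i j = 2)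
    (hc : ∀ j ∈ T, ∑ i ∈ S, A i j = 2) : IsSquareOn S T (blockRestrict A S T) where
  supp i j h := by
    unfold blockRestrict at h
    by_contra h'
    exact h (if_neg h')
  row_sum i hi := by
    rw [← hr i hi]
    exact Finset.sum_congr rfl fun j hj => blockRestrict_apply_of_mem hi hj
  col_sum j hj := by
    rw [← hc j hj]
    exact Finset.sum_congr rfl fun i hi => blockRestrict_apply_of_mem hi hj

theorem IsSquareOn.isSquareOn_sdiff (h : IsSquareOn U V A) (hc : IsComponent 2 A S T) :
    IsSquareOn (U \ S) (V \ T) (blockRestrict A (U \ S) (V \ T)) := by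
  obtain ⟨hS, hT⟩ := h.subset_of_isComponent hc
  have key := ((h.isComponent_iff hS hT).mp hc).2
  apply isSquareOn_blockRestrict
  · intro i hi
    rw [Finset.mem_sdiff] at hi
    rw [← h.row_sum i hi.1, sum_subset_eq_sum_iff Finset.sdiff_subset]
    exact fun j hj hij => Finset.mem_sdiff.mpr ⟨hj, fun hjT => hi.2 ((key i j hij).mpr hjT)⟩
  · intro j hj
    rw [Finset.mem_sdiff] at hj
    rw [← h.col_sum j hj.1, sum_subset_eq_sum_iff Finset.sdiff_subset (fun i => A i j)]
    exact fun i hi hij => Finset.mem_sdiff.mpr ⟨hi, fun hiS => hj.2 ((key i j hij).mp hiS)⟩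

theorem IsSquareOn.add (hS : S ⊆ U) (hT : T ⊆ V) (hB : IsSquareOn S T B)
    (hC : IsSquareOn (U \ S) (V \ T) C) : IsSquareOn U V (B + C) where
  supp i j hij := by
    rw [Matrix.add_apply] at hij
    by_cases hb : B i j = 0
    · obtain ⟨h1, h2⟩ := hC.supp i j (by omega)
      exact ⟨(Finset.mem_sdiff.mp h1).1, (Finset.mem_sdiff.mp h2).1⟩
    · obtain ⟨h1, h2⟩ := hB.supp i j hb
      exact ⟨hS h1, hT h2⟩
  row_sum i hi := by
    simp only [Matrix.add_apply]
    rw [← Finset.sum_sdiff hT]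
    by_cases hiS : i ∈ S
    · rw [Finset.sum_eq_zero, zero_add, Finset.sum_add_distrib, hB.row_sum i hiS,
        Finset.sum_eq_zero, add_zero]
      · intro j hj
        by_contra h
        exact (Finset.mem_sdiff.mp (hC.supp i j h).1).2 hiS
      · intro j hj
        by_contra h
        by_cases hb : B i j = 0
        · exact (Finset.mem_sdiff.mp (hC.supp i j (by omega)).1).2 hiS
        · exact (Finset.mem_sdiff.mp hj).2 (hB.supp i j hb).2
    · have hi' : i ∈ U \ S := Finset.mem_sdiff.mpr ⟨hi, hiS⟩
      rw [Finset.sum_eq_zero (s := T), add_zero, Finset.sum_add_distrib, hC.row_sum i hi',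
        Finset.sum_eq_zero, zero_add]
      · intro j hj
        by_contra h
        exact hiS (hB.supp i j h).1
      · intro j hj
        by_contra h
        by_cases hb : B i j = 0
        · exact (Finset.mem_sdiff.mp (hC.supp i j (by omega)).2).2 hj
        · exact hiS (hB.supp i j hb).1
  col_sum j hj := by
    simp only [Matrix.add_apply]
    rw [← Finset.sum_sdiff hS]
    by_cases hjT : j ∈ T
    · rw [Finset.sum_eq_zero, zero_add, Finset.sum_add_distrib, hB.col_sum j hjT,
        Finset.sum_eq_zero, add_zero]
      · intro i hi
        by_contra h
        exact (Finset.mem_sdiff.mp (hC.supp i j h).2).2 hjT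
      · intro i hi
        by_contra h
        by_cases hb : B i j = 0
        · exact (Finset.mem_sdiff.mp (hC.supp i j (by omega)).2).2 hjT
        · exact (Finset.mem_sdiff.mp hi).2 (hB.supp i j hb).1
    · have hj' : j ∈ V \ T := Finset.mem_sdiff.mpr ⟨hj, hjT⟩
      rw [Finset.sum_eq_zero (s := S), add_zero, Finset.sum_add_distrib, hC.col_sum j hj',
        Finset.sum_eq_zero, zero_add]
      · intro i hi
        by_contra h
        exact hjT (hB.supp i j h).2
      · intro i hi
        by_contra h
        by_cases hb : B i j = 0
        · exact (Finset.mem_sdiff.mp (hC.supp i j (by omega)).1).2 hi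
        · exact hjT (hB.supp i j hb).2

open scoped Classical in
-- No non-zero entry links a component to its complement, so restriction to the two diagonal blocks
-- is inverse to addition. The bound on `S.card` is needed for the sum of two blocks to be
-- admissible again.
theorem card_boundedSquares_filter (hS : S ⊆ U) (hT : T ⊆ V) (hk : S.card ≤ k) :
    ((boundedSquares k U V).filter fun A => IsIrreducibleComponent 2 A S T).card =
      (irreducibleSquares S T).card * (boundedSquares k (U \ S) (V \ T)).card := by
  rw [← Finset.card_product]
  have hC0 : ∀ C, IsSquareOn (U \ S) (V \ T) C → ∀ i j, (i ∈ S ∨ j ∈ T) → C i j = 0 := by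
    intro C hC i j hij
    by_contra h
    obtain ⟨h1, h2⟩ := hC.supp i j h
    rcases hij with h' | h'
    · exact (Finset.mem_sdiff.mp h1).2 h'
    · exact (Finset.mem_sdiff.mp h2).2 h'
  have hB0 : ∀ B, IsSquareOn S T B → ∀ i j, (i ∉ S ∨ j ∉ T) → B i j = 0 := by
    intro B hB i j hij
    by_contra h
    obtain ⟨h1, h2⟩ := hB.supp i j h
    rcases hij with h' | h'
    · exact h' h1
    · exact h' h2
  refine Finset.card_nbij' (fun A => (blockRestrict A S T, blockRestrict A (U \ S) (V \ T)))
    (fun p => p.1 + p.2) ?_ ?_ ?_ ?_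
  · intro A hA
    simp only [Finset.coe_filter, mem_boundedSquares, Set.mem_ofPred_eq] at hA
    obtain ⟨⟨h1, h2⟩, h3⟩ := hA
    simp only [Finset.coe_product, Set.mem_prod, Finset.mem_coe, mem_irreducibleSquares,
      mem_boundedSquares]
    refine ⟨⟨isSquareOn_blockRestrict h3.1.row_sum h3.1.col_sum,
      h3.congr fun i hi j hj => (blockRestrict_apply_of_mem hi hj).symm⟩,
      h1.isSquareOn_sdiff h3.1, fun S' T' h' => h2 S' T' (h'.congr fun i hi j hj => ?_)⟩
    obtain ⟨a, b⟩ := (h1.isSquareOn_sdiff h3.1).subset_of_isComponent h'.1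
    exact blockRestrict_apply_of_mem (a hi) (b hj)
  · rintro ⟨B, C⟩ hBC
    simp only [Finset.coe_product, Set.mem_prod, Finset.mem_coe, mem_irreducibleSquares,
      mem_boundedSquares] at hBC
    obtain ⟨⟨hB1, hB2⟩, hC1, hC2⟩ := hBC
    have hA := IsSquareOn.add hS hT hB1 hC1
    have hAS : IsIrreducibleComponent 2 (B + C) S T := hB2.congr fun i hi j hj => by
      rw [Matrix.add_apply, hC0 C hC1 i j (Or.inl hi), add_zero]
    simp only [Finset.coe_filter, mem_boundedSquares, Set.mem_ofPred_eq]
    refine ⟨⟨hA, fun S' T' h' => ?_⟩, hAS⟩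
    by_cases hd : Disjoint S S'
    · have hd' := hA.disjoint_cols hAS.1 h'.1 hd
      refine hC2 S' T' (h'.congr fun i hi j hj => ?_)
      rw [Matrix.add_apply, hB0 B hB1 i j (Or.inl (Finset.disjoint_right.mp hd hi)), zero_add]
    · obtain ⟨u, hu, hu'⟩ := Finset.not_disjoint_iff.mp hd
      rw [← (hA.irreducible_unique hAS h' hu hu').1]
      exact hk
  · intro A hA
    simp only [Finset.coe_filter, mem_boundedSquares, Set.mem_ofPred_eq] at hA
    obtain ⟨⟨h1, h2⟩, h3⟩ := hA
    have key := ((h1.isComponent_iff hS hT).mp h3.1).2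
    ext i j
    simp only [Matrix.add_apply, blockRestrict, Finset.mem_sdiff]
    by_cases hij : A i j = 0
    · simp [hij]
    · have h4 := key i j hij
      obtain ⟨h5, h6⟩ := h1.supp i j hij
      by_cases hi : i ∈ S
      · simp [hi, h4.mp hi]
      · have hj : j ∉ T := fun hj => hi (h4.mpr hj)
        simp [hi, h5, h6, hj]
  · rintro ⟨B, C⟩ hBC
    simp only [Finset.coe_product, Set.mem_prod, Finset.mem_coe, mem_irreducibleSquares,
      mem_boundedSquares] at hBC
    obtain ⟨⟨hB1, hB2⟩, hC1, hC2⟩ := hBC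
    ext i j
    · simp only [Matrix.add_apply, blockRestrict]
      split_ifs with h
      · rw [hC0 C hC1 i j (Or.inl h.1), add_zero]
      · rw [hB0 B hB1 i j (by tauto)]
    · simp only [Matrix.add_apply, blockRestrict]
      split_ifs with h
      · rw [hB0 B hB1 i j (Or.inl (Finset.mem_sdiff.mp h.1).2), zero_add]
      · by_contra hne
        exact h (hC1.supp i j (Ne.symm hne))

open scoped Classical in
-- Exactly one irreducible component passes through the row `u`; sorting by it counts each matrix
-- once, where a sum over all components would count it once per component.
theorem card_boundedSquares_eq_sum {u : Fin n} (hu : u ∈ U) (k : ℕ) (V : Finset (Fin n)) :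
    (boundedSquares k U V).card = ∑ S ∈ U.powerset.filter (u ∈ ·),
      ∑ T ∈ V.powersetCard S.card, if S.card ≤ k then
        (irreducibleSquares S T).card * (boundedSquares k (U \ S) (V \ T)).card else 0 := by
  have hcover : boundedSquares k U V = (U.powerset.filter (u ∈ ·)).biUnion fun S =>
      (V.powersetCard S.card).biUnion fun T =>
        (boundedSquares k U V).filter fun A => IsIrreducibleComponent 2 A S T := by
    ext A
    simp only [Finset.mem_biUnion, Finset.mem_filter, Finset.mem_powerset, Finset.mem_powersetCard]
    constructor
    · intro hA
      have h := (mem_boundedSquares.mp hA).1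
      obtain ⟨S, T, hST, huS⟩ := h.exists_irreducible hu
      obtain ⟨hS, hT⟩ := h.subset_of_isComponent hST.1
      exact ⟨S, ⟨hS, huS⟩, T, ⟨hT, hST.1.card_eq.symm⟩, hA, hST⟩
    · rintro ⟨S, -, T, -, hA, -⟩
      exact hA
  conv_lhs => rw [hcover]
  rw [Finset.card_biUnion]
  · refine Finset.sum_congr rfl fun S hS => ?_
    rw [Finset.mem_filter, Finset.mem_powerset] at hS
    rw [Finset.card_biUnion]
    · refine Finset.sum_congr rfl fun T hT => ?_
      rw [Finset.mem_powersetCard] at hT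
      split_ifs with hk
      · exact card_boundedSquares_filter hS.1 hT.1 hk
      · rw [Finset.card_eq_zero, Finset.filter_eq_empty_iff]
        exact fun A hA h => hk ((mem_boundedSquares.mp hA).2 S T h)
    · intro T _ T' _ hne
      rw [Function.onFun, Finset.disjoint_left]
      intro A hA hA'
      rw [Finset.mem_filter] at hA hA'
      exact hne ((mem_boundedSquares.mp hA.1).1.irreducible_unique hA.2 hA'.2 hS.2 hS.2).2
  · intro S hS S' hS' hne
    rw [Function.onFun, Finset.disjoint_left]
    intro A hA hA'
    simp only [Finset.mem_biUnion, Finset.mem_filter] at hA hA'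
    obtain ⟨T, -, hA1, hA2⟩ := hA
    obtain ⟨T', -, -, hA2'⟩ := hA'
    exact hne ((mem_boundedSquares.mp hA1).1.irreducible_unique hA2 hA2'
      (Finset.mem_filter.mp hS).2 (Finset.mem_filter.mp hS').2).1

end Recursion

/-! ### Irreducible blocks as pairs of bijections, and their number -/

section Pairs

variable {n : ℕ} {S T : Finset (Fin n)}

/-- The sum of the two permutation matrices of the bijections `σ`, `τ` between `S` and `T`. -/
def pairMatrix (σ τ : S ≃ T) : Matrix (Fin n) (Fin n) ℕ := fun i j =>
  if h : i ∈ S then (if (σ ⟨i, h⟩ : Fin n) = j then 1 else 0) + (if (τ ⟨i, h⟩ : Fin n) = j then 1 else 0)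
  else 0

theorem pairMatrix_coe (σ τ : S ≃ T) (x : S) (j : Fin n) :
    pairMatrix σ τ x j =
      (if (σ x : Fin n) = j then 1 else 0) + (if (τ x : Fin n) = j then 1 else 0) := by
  simp [pairMatrix]

theorem pairMatrix_coe_coe (σ τ : S ≃ T) (x : S) (y : T) :
    pairMatrix σ τ x y = (if σ x = y then 1 else 0) + (if τ x = y then 1 else 0) := by
  simp only [pairMatrix_coe, Subtype.coe_inj]

theorem pairMatrix_comm (σ τ : S ≃ T) : pairMatrix σ τ = pairMatrix τ σ := by
  ext i j
  simp only [pairMatrix]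
  split_ifs <;> rfl

theorem sum_ite_equiv_eq (σ : S ≃ T) (y : T) : ∑ x : S, (if σ x = y then 1 else 0) = 1 := by
  have : ∀ x, (σ x = y) = (x = σ.symm y) := fun x => by rw [Equiv.eq_symm_apply]
  simp [this]

theorem isSquareOn_pairMatrix (σ τ : S ≃ T) : IsSquareOn S T (pairMatrix σ τ) where
  supp i j h := by
    by_cases hi : i ∈ S
    · refine ⟨hi, ?_⟩
      by_contra hj
      apply h
      have h1 : ∀ ρ : S ≃ T, (ρ ⟨i, hi⟩ : Fin n) ≠ j := fun ρ e => hj (e ▸ (ρ ⟨i, hi⟩).2)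
      simp [pairMatrix, h1]
    · simp [pairMatrix, hi] at h
  row_sum i hi := by
    rw [← Finset.sum_coe_sort T]
    have := fun y => pairMatrix_coe_coe σ τ ⟨i, hi⟩ y
    simp only at this
    simp [this, Finset.sum_add_distrib]
  col_sum j hj := by
    rw [← Finset.sum_coe_sort S]
    have := fun x => pairMatrix_coe_coe σ τ x ⟨j, hj⟩
    simp only at this
    simp only [this, Finset.sum_add_distrib, sum_ite_equiv_eq]

theorem pairMatrix_ne_zero_iff (σ τ : S ≃ T) (x : S) (y : T) :
    pairMatrix σ τ x y ≠ 0 ↔ σ x = y ∨ τ x = y := by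
  rw [pairMatrix_coe_coe]
  by_cases h1 : σ x = y <;> by_cases h2 : τ x = y <;> simp [h1, h2]

/-- With π = σ⁻¹ ∘ τ, the rows x and π x share the column τ x = σ (π x). Connected sets of rows are
therefore the orbits of π, and irreducibility means that there is only one. -/
theorem isIrreducibleComponent_pairMatrix_iff (hS : S.Nonempty) (σ τ : S ≃ T) :
    IsIrreducibleComponent 2 (pairMatrix σ τ) S T ↔
      ∀ x y, Equiv.Perm.SameCycle (τ.trans σ.symm) x y := by
  set π : Equiv.Perm S := τ.trans σ.symm with hπ
  have hστ : ∀ x, τ x = σ (π x) := fun x => by simp [hπ]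
  have hsq := isSquareOn_pairMatrix σ τ
  constructor
  · intro h x y
    set S' : Finset (Fin n) := (Finset.univ.filter fun z => π.SameCycle x z).map
      (Function.Embedding.subtype _) with hS'
    set T' : Finset (Fin n) := (Finset.univ.filter fun z => π.SameCycle x (σ.symm z)).map
      (Function.Embedding.subtype _) with hT'
    have mS : ∀ z : S, (z : Fin n) ∈ S' ↔ π.SameCycle x z := fun z => by simp [hS']
    have mT : ∀ z : T, (z : Fin n) ∈ T' ↔ π.SameCycle x (σ.symm z) := fun z => by simp [hT']
    have sS : S' ⊆ S := fun i hi => by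
      obtain ⟨z, -, rfl⟩ := Finset.mem_map.mp hi
      exact z.2
    have sT : T' ⊆ T := fun i hi => by
      obtain ⟨z, -, rfl⟩ := Finset.mem_map.mp hi
      exact z.2
    have hc : IsComponent 2 (pairMatrix σ τ) S' T' := by
      rw [hsq.isComponent_iff sS sT]
      refine ⟨⟨x, (mS x).mpr (Equiv.Perm.SameCycle.refl π x)⟩, fun i j hij => ?_⟩
      obtain ⟨hi, hj⟩ := hsq.supp i j hij
      rw [mS ⟨i, hi⟩, mT ⟨j, hj⟩]
      rcases (pairMatrix_ne_zero_iff σ τ ⟨i, hi⟩ ⟨j, hj⟩).mp hij with h1 | h1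
      · rw [← h1, Equiv.symm_apply_apply]
      · rw [← h1, hστ, Equiv.symm_apply_apply, Equiv.Perm.sameCycle_apply_right]
    exact (mS y).mp (((h.2 S' T' hc sS sT).1).symm ▸ y.2)
  · intro h
    refine ⟨hsq.isComponent_self hS, fun S' T' hc sS sT => ?_⟩
    obtain ⟨⟨i0, hi0⟩, hcl⟩ := (hsq.isComponent_iff sS sT).mp hc
    have step : ∀ x : S, (x : Fin n) ∈ S' → ((π x : S) : Fin n) ∈ S' := fun x hx => by
      have h1 := (hcl x (τ x) ((pairMatrix_ne_zero_iff σ τ x (τ x)).mpr (Or.inr rfl))).mp hx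
      exact (hcl (π x) (τ x) ((pairMatrix_ne_zero_iff σ τ (π x) (τ x)).mpr
        (Or.inl (hστ x).symm))).mpr h1
    have e : S' = S := by
      refine sS.antisymm fun i hi => ?_
      obtain ⟨m, -, -, hm⟩ := (h ⟨i0, sS hi0⟩ ⟨i, hi⟩).exists_pow_eq''
      have : ∀ m : ℕ, (((π ^ m) ⟨i0, sS hi0⟩ : S) : Fin n) ∈ S' := fun m => by
        induction m with
        | zero => exact hi0
        | succ m ih => rw [pow_succ', Equiv.Perm.mul_apply]; exact step _ ih
      have h2 := this m
      rwa [hm] at h2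
    refine ⟨e, Finset.eq_of_subset_of_card_le sT ?_⟩
    rw [← hc.card_eq, e, (hsq.isComponent_self hS).card_eq]

/-- Row x determines only the unordered pair {σ x, τ x}. By injectivity, the way it is ordered at x
forces the way it is ordered at π x; as π is transitive, one global choice remains. -/
theorem pairMatrix_eq_iff {σ τ : S ≃ T} (h : ∀ x y, Equiv.Perm.SameCycle (τ.trans σ.symm) x y)
    {σ' τ' : S ≃ T} :
    pairMatrix σ' τ' = pairMatrix σ τ ↔ (σ' = σ ∧ τ' = τ) ∨ (σ' = τ ∧ τ' = σ) := by
  constructor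
  swap
  · rintro (⟨rfl, rfl⟩ | ⟨rfl, rfl⟩)
    · rfl
    · exact pairMatrix_comm _ _
  intro he
  set π : Equiv.Perm S := τ.trans σ.symm with hπ
  have hστ : ∀ x, τ x = σ (π x) := fun x => by simp [hπ]
  have hpair : ∀ x, (σ' x = σ x ∧ τ' x = τ x) ∨ (σ' x = τ x ∧ τ' x = σ x) := fun x => by
    have h1 := fun y : T => congrFun (congrFun he x) y
    simp only [pairMatrix_coe_coe] at h1
    have ha := h1 (σ' x)
    have hb := h1 (τ' x)
    have hc := h1 (σ x)
    have hd := h1 (τ x)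
    grind
  by_cases hz : ∃ x, σ' x = σ x
  · left
    obtain ⟨x0, hx0⟩ := hz
    have step : ∀ x, σ' x = σ x → σ' (π x) = σ (π x) := fun x hx => by
      rcases hpair (π x) with h1 | h1
      · exact h1.1
      · have h2 : τ' x = τ x := by
          rcases hpair x with h3 | h3
          · exact h3.2
          · rw [h3.2, ← hx, h3.1]
        have h4 : τ' (π x) = τ' x := by rw [h1.2, h2, hστ]
        rw [τ'.injective h4, hx]
    have hall : ∀ y, σ' y = σ y := fun y => by
      obtain ⟨m, -, -, hm⟩ := (h x0 y).exists_pow_eq''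
      have : ∀ m : ℕ, σ' ((π ^ m) x0) = σ ((π ^ m) x0) := fun m => by
        induction m with
        | zero => exact hx0
        | succ m ih => rw [pow_succ', Equiv.Perm.mul_apply]; exact step _ ih
      rw [← hm]
      exact this m
    refine ⟨Equiv.ext hall, Equiv.ext fun y => ?_⟩
    rcases hpair y with h3 | h3
    · exact h3.2
    · rw [h3.2, ← hall y, h3.1]
  · right
    push Not at hz
    have : ∀ x, σ' x = τ x ∧ τ' x = σ x := fun x => (hpair x).resolve_left fun h1 => hz x h1.1
    exact ⟨Equiv.ext fun x => (this x).1, Equiv.ext fun x => (this x).2⟩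

/-- Hall's condition by double counting: a set R of rows carries total mass 2|R|, all of it in the
neighbouring columns, which hold at most 2 each. -/
theorem exists_equiv_of_isSquareOn {A : Matrix (Fin n) (Fin n) ℕ} (h : IsSquareOn S T A) :
    ∃ σ : S ≃ T, ∀ x : S, A x (σ x) ≠ 0 := by
  have hcard : Fintype.card S = Fintype.card T := by
    simpa using card_eq_of_sums_eq_two h.row_sum h.col_sum
  have hall := (Fintype.all_card_le_filter_rel_iff_exists_injective
    (fun (x : S) (y : T) => A x y ≠ 0)).mp ?_
  · obtain ⟨f, hf, hf'⟩ := hall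
    exact ⟨Equiv.ofBijective f ((Fintype.bijective_iff_injective_and_card f).mpr ⟨hf, hcard⟩), hf'⟩
  · intro R
    set N : Finset T := Finset.univ.filter fun y => ∃ x ∈ R, A x y ≠ 0 with hN
    have h1 : ∑ x ∈ R, ∑ y : T, A x y = R.card * 2 := by
      rw [Finset.sum_congr rfl fun (x : S) _ => (Finset.sum_coe_sort T (fun y => A x y)).trans
        (h.row_sum x x.2), Finset.sum_const, smul_eq_mul]
    have h2 : ∑ x ∈ R, ∑ y : T, A x y = ∑ x ∈ R, ∑ y ∈ N, A x y := by
      refine Finset.sum_congr rfl fun x hx => ?_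
      symm
      refine Finset.sum_subset (Finset.subset_univ _) fun y _ hy => ?_
      by_contra hxy
      exact hy (by simp only [hN, Finset.mem_filter, Finset.mem_univ, true_and]; exact ⟨x, hx, hxy⟩)
    have h3 : ∑ x ∈ R, ∑ y ∈ N, A x y ≤ N.card * 2 := by
      refine (Finset.sum_comm (f := fun (x : S) (y : T) => A x y)).trans_le ?_
      rw [← smul_eq_mul, ← Finset.sum_const]
      refine Finset.sum_le_sum fun y _ => ?_
      rw [← h.col_sum y y.2, ← Finset.sum_coe_sort S]
      exact Finset.sum_le_sum_of_subset (Finset.subset_univ _)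
    omega

/-- Subtracting the permutation matrix found by Hall's theorem leaves line sums 1, hence a second
permutation matrix. -/
theorem exists_pairMatrix_eq {A : Matrix (Fin n) (Fin n) ℕ} (h : IsSquareOn S T A) :
    ∃ σ τ : S ≃ T, pairMatrix σ τ = A := by
  have hcard : Fintype.card S = Fintype.card T := by
    simpa using card_eq_of_sums_eq_two h.row_sum h.col_sum
  obtain ⟨σ, hσ⟩ := exists_equiv_of_isSquareOn h
  set B : S → T → ℕ := fun x y => A x y - if σ x = y then 1 else 0 with hB
  have hAB : ∀ (x : S) (y : T), A x y = (if σ x = y then 1 else 0) + B x y := fun x y => by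
    simp only [hB]
    split_ifs with e
    · have := hσ x
      rw [e] at this
      omega
    · simp
  have hr : ∀ x, ∑ y, B x y = 1 := fun x => by
    have h1 := h.row_sum x x.2
    rw [← Finset.sum_coe_sort T, Finset.sum_congr rfl fun y _ => hAB x y,
      Finset.sum_add_distrib, Finset.sum_ite_eq, if_pos (Finset.mem_univ _)] at h1
    omega
  have hc : ∀ y, ∑ x, B x y = 1 := fun y => by
    have h1 := h.col_sum y y.2
    rw [← Finset.sum_coe_sort S, Finset.sum_congr rfl fun x _ => hAB x y,
      Finset.sum_add_distrib, sum_ite_equiv_eq] at h1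
    omega
  have hex : ∀ x, ∃ y, B x y ≠ 0 := fun x => by
    obtain ⟨y, -, hy⟩ := Finset.exists_ne_zero_of_sum_ne_zero ((hr x).trans_ne one_ne_zero)
    exact ⟨y, hy⟩
  choose t ht using hex
  have hinj : Function.Injective t := fun x x' hxx => by
    by_contra hne
    have h1 : B x (t x) + B x' (t x) ≤ ∑ z, B z (t x) := by
      rw [← Finset.sum_pair (f := fun z => B z (t x)) hne]
      exact Finset.sum_le_sum_of_subset (Finset.subset_univ _)
    rw [hc] at h1
    have h2 := ht x
    have h3 := ht x'
    rw [← hxx] at h3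
    omega
  let τ : S ≃ T := Equiv.ofBijective t ((Fintype.bijective_iff_injective_and_card t).mpr ⟨hinj, hcard⟩)
  have hτ : ∀ x, τ x = t x := fun x => rfl
  have hBt : ∀ x y, B x y = if τ x = y then 1 else 0 := fun x y => by
    rw [hτ]
    split_ifs with e
    · rw [← e]
      have h1 : B x (t x) ≤ ∑ z, B x z := Finset.single_le_sum (fun _ _ => Nat.zero_le _)
        (Finset.mem_univ _)
      have := ht x
      have := hr x
      omega
    · have h1 : B x (t x) + B x y ≤ ∑ z, B x z := by
        rw [← Finset.sum_pair (f := B x) e]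
        exact Finset.sum_le_sum_of_subset (Finset.subset_univ _)
      have := ht x
      have := hr x
      omega
  refine ⟨σ, τ, ?_⟩
  ext i j
  by_cases hij : i ∈ S ∧ j ∈ T
  · have h1 := pairMatrix_coe_coe σ τ ⟨i, hij.1⟩ ⟨j, hij.2⟩
    have h2 := hAB ⟨i, hij.1⟩ ⟨j, hij.2⟩
    rw [hBt] at h2
    exact h1.trans h2.symm
  · have h1 : pairMatrix σ τ i j = 0 := by
      by_contra h0
      exact hij ((isSquareOn_pairMatrix σ τ).supp i j h0)
    have h2 : A i j = 0 := by
      by_contra h0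
      exact hij (h.supp i j h0)
    rw [h1, h2]

open scoped Classical in
theorem card_transitive_perm {X : Type*} [Fintype X] [Nonempty X] :
    (Finset.univ.filter fun π : Equiv.Perm X => ∀ x y, π.SameCycle x y).card =
      (Fintype.card X - 1).factorial := by
  -- On one point the transitive permutation is the identity, whose cycle type is empty, so the
  -- count by cycle type covers only larger sets.
  rcases Nat.lt_or_ge 1 (Fintype.card X) with h | h
  · have h1 := Equiv.Perm.card_of_cycleType_singleton (α := X) (n := Fintype.card X) h le_rfl
    rw [Nat.choose_self, mul_one] at h1
    rw [← h1]
    congr 1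
    ext π
    simp only [Finset.mem_filter, Finset.mem_univ, true_and]
    have : Nontrivial X := Fintype.one_lt_card_iff_nontrivial.mp h
    constructor
    · intro hπ
      have hcyc : π.IsCycleOn (Set.univ) := ⟨Set.bijOn_univ.mpr π.bijective, fun x _ y _ => hπ x y⟩
      have hc : π.IsCycle := Equiv.Perm.isCycle_iff_exists_isCycleOn.mpr
        ⟨Set.univ, Set.nontrivial_univ, hcyc, fun _ _ => Set.mem_univ _⟩
      have hs : π.support = Finset.univ := by
        ext x
        simp only [Equiv.Perm.mem_support, Finset.mem_univ, iff_true]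
        exact hcyc.apply_ne Set.nontrivial_univ (Set.mem_univ x)
      rw [hc.cycleType, hs, Finset.card_univ]
    · intro hπ x y
      have hc : π.IsCycle := by
        rw [← Equiv.Perm.card_cycleType_eq_one, hπ, Multiset.card_singleton]
      have hs : π.support = Finset.univ := by
        apply Finset.eq_univ_of_card
        rw [← Equiv.Perm.sum_cycleType, hπ, Multiset.sum_singleton]
      exact hc.sameCycle (Equiv.Perm.mem_support.mp (hs ▸ Finset.mem_univ x))
        (Equiv.Perm.mem_support.mp (hs ▸ Finset.mem_univ y))
  · have : Subsingleton X := Fintype.card_le_one_iff_subsingleton.mp h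
    have h1 : Fintype.card X - 1 = 0 := by omega
    rw [h1, Nat.factorial_zero, Finset.filter_true_of_mem, Finset.card_univ, Fintype.card_unique]
    intro π _ x y
    rw [Subsingleton.elim x y]

open scoped Classical in
theorem card_irreducible_pairs (hS : S.Nonempty) (hST : S.card = T.card) :
    (Finset.univ.filter fun p : (S ≃ T) × (S ≃ T) =>
      IsIrreducibleComponent 2 (pairMatrix p.1 p.2) S T).card =
        S.card.factorial * (S.card - 1).factorial := by
  have : Nonempty S := hS.to_subtype
  obtain ⟨e⟩ : Nonempty (S ≃ T) := Fintype.card_eq.mp (by simpa using hST)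
  have h1 := card_transitive_perm (X := S)
  rw [Fintype.card_coe] at h1
  have h2 : Fintype.card (S ≃ T) = S.card.factorial := by
    rw [Fintype.card_equiv e, Fintype.card_coe]
  rw [← h1, ← h2, ← Finset.card_univ, ← Finset.card_product]
  refine Finset.card_nbij' (fun p => (p.1, p.2.trans p.1.symm)) (fun p => (p.1, p.2.trans p.1))
    ?_ ?_ ?_ ?_
  · rintro ⟨σ, τ⟩ hp
    simp only [Finset.coe_filter, Finset.mem_univ, true_and, Set.mem_ofPred_eq,
      isIrreducibleComponent_pairMatrix_iff hS] at hp
    simpa using hp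
  · rintro ⟨σ, π⟩ hp
    simp only [Finset.coe_product, Finset.coe_univ, Finset.coe_filter, Finset.mem_univ, true_and,
      Set.mem_prod, Set.mem_univ, Set.mem_ofPred_eq] at hp
    simp only [Finset.coe_filter, Finset.mem_univ, true_and, Set.mem_ofPred_eq,
      isIrreducibleComponent_pairMatrix_iff hS]
    have : (Equiv.trans (π.trans σ) σ.symm : Equiv.Perm S) = π := by ext; simp
    rw [this]
    exact hp
  · rintro ⟨σ, τ⟩ _
    ext <;> simp
  · rintro ⟨σ, τ⟩ _
    ext <;> simp

/-- Unordered pairs: the map from pairs to matrices is two-to-one, except in size 1 where both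
bijections coincide. -/
theorem card_irreducibleSquares (hS : S.Nonempty) (hST : S.card = T.card) :
    (irreducibleSquares S T).card * (if S.card = 1 then 1 else 2) =
      S.card.factorial * (S.card - 1).factorial := by
  classical
  rw [← card_irreducible_pairs hS hST]
  symm
  have hmaps : ∀ p ∈ (Finset.univ.filter fun p : (S ≃ T) × (S ≃ T) =>
      IsIrreducibleComponent 2 (pairMatrix p.1 p.2) S T), pairMatrix p.1 p.2 ∈
        irreducibleSquares S T := fun p hp =>
    mem_irreducibleSquares.mpr ⟨isSquareOn_pairMatrix _ _, (Finset.mem_filter.mp hp).2⟩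
  rw [Finset.card_eq_sum_card_fiberwise hmaps, ← smul_eq_mul, ← Finset.sum_const]
  refine Finset.sum_congr rfl fun A hA => ?_
  obtain ⟨hA1, hA2⟩ := mem_irreducibleSquares.mp hA
  obtain ⟨σ, τ, rfl⟩ := exists_pairMatrix_eq hA1
  have hsame := (isIrreducibleComponent_pairMatrix_iff hS σ τ).mp hA2
  have hfib : ((Finset.univ.filter fun p : (S ≃ T) × (S ≃ T) =>
      IsIrreducibleComponent 2 (pairMatrix p.1 p.2) S T).filter
        fun p => pairMatrix p.1 p.2 = pairMatrix σ τ) = {(σ, τ), (τ, σ)} := by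
    ext ⟨σ', τ'⟩
    simp only [Finset.mem_filter, Finset.mem_univ, true_and, Finset.mem_insert,
      Finset.mem_singleton, Prod.mk.injEq]
    rw [← pairMatrix_eq_iff hsame]
    exact ⟨fun h => h.2, fun h => ⟨by rw [h]; exact hA2, h⟩⟩
  rw [hfib]
  split_ifs with h1
  · have : Subsingleton S := by
      rw [← Fintype.card_le_one_iff_subsingleton, Fintype.card_coe, h1]
    have : σ = τ := by
      have : Subsingleton T := by
        rw [← Fintype.card_le_one_iff_subsingleton, Fintype.card_coe, ← hST, h1]
      exact Subsingleton.elim _ _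
    simp [this]
  · refine Finset.card_pair fun h => h1 ?_
    have hστ : σ = τ := (Prod.mk.inj h).1
    subst hστ
    rw [← Fintype.card_coe, Fintype.card_eq_one_iff]
    obtain ⟨x, hx⟩ := hS
    refine ⟨⟨x, hx⟩, fun y => ?_⟩
    have := hsame y ⟨x, hx⟩
    rw [Equiv.self_trans_symm] at this
    exact Equiv.Perm.sameCycle_one.mp this

end Pairs

/-! ### The exponential formula for the number of squares -/

section Counting

/-- The coefficients of `exp (∑ j, e j * x ^ (j + 1) / (j + 1))`, given by the recursion that the
logarithmic derivative yields. -/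
noncomputable def expCoeff (e : ℕ → ℝ) : ℕ → ℝ
  | 0 => 1
  | n + 1 => (∑ i : Fin (n + 1), e i * expCoeff e (n - i)) / (n + 1)
decreasing_by omega

theorem expCoeff_zero (e : ℕ → ℝ) : expCoeff e 0 = 1 := by rw [expCoeff]

theorem expCoeff_succ (e : ℕ → ℝ) (n : ℕ) :
    (n + 1) * expCoeff e (n + 1) = ∑ i ∈ Finset.range (n + 1), e i * expCoeff e (n - i) := by
  rw [expCoeff, mul_div_cancel₀ _ (by positivity)]
  exact Fin.sum_univ_eq_sum_range (fun i => e i * expCoeff e (n - i)) (n + 1)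

/-- `k * c_k`, where `c_k * k! ^ 2` is the number of irreducible squares of size `k = j + 1`. -/
noncomputable def weight (j : ℕ) : ℝ := if j = 0 then 1 else 1 / 2

/-- The weights of the components of size at most `k`. -/
noncomputable def weightUpTo (k j : ℕ) : ℝ := if j < k then weight j else 0

variable {n : ℕ} {S T U V : Finset (Fin n)}

theorem card_irreducibleSquares_eq (hS : S.Nonempty) (hST : S.card = T.card) :
    ((irreducibleSquares S T).card : ℝ) =
      S.card.factorial * (S.card - 1).factorial * weight (S.card - 1) := by
  have h := card_irreducibleSquares hS hST
  have hpos := hS.card_pos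
  have h' : ((irreducibleSquares S T).card : ℝ) * (if S.card = 1 then 1 else 2) =
      S.card.factorial * (S.card - 1).factorial := by
    rw [← Nat.cast_mul, ← h]
    push_cast
    rfl
  rw [← h', weight]
  by_cases h1 : S.card = 1
  · simp [h1]
  · have : S.card - 1 ≠ 0 := by omega
    simp [h1, this]

theorem boundedSquares_empty (k : ℕ) : boundedSquares k (∅ : Finset (Fin n)) ∅ = {0} := by
  ext A
  rw [mem_boundedSquares, Finset.mem_singleton]
  constructor
  · rintro ⟨h, -⟩
    ext i j
    by_contra hij
    exact absurd (h.supp i j hij).1 (Finset.notMem_empty i)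
  · rintro rfl
    have h : IsSquareOn (∅ : Finset (Fin n)) ∅ (0 : Matrix (Fin n) (Fin n) ℕ) :=
      ⟨fun i j h => absurd rfl h, by simp, by simp⟩
    refine ⟨h, fun S T hST => ?_⟩
    obtain ⟨i, hi⟩ := hST.1.rows_nonempty
    exact absurd ((h.subset_of_isComponent hST.1).1 hi) (Finset.notMem_empty i)

theorem sum_powerset_mem_apply_card {ι : Type*} [DecidableEq ι] {U : Finset ι} {u : ι} (hu : u ∈ U)
    (g : ℕ → ℝ) :
    ∑ S ∈ U.powerset.filter (u ∈ ·), g S.card =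
      ∑ i ∈ Finset.range U.card, ((U.card - 1).choose i : ℝ) * g (i + 1) := by
  have hpos : 0 < U.card := Finset.card_pos.mpr ⟨u, hu⟩
  have h1 := Finset.sum_powerset_apply_card (fun i => g (i + 1)) (x := U.erase u)
  rw [Finset.card_erase_of_mem hu, Nat.sub_add_cancel hpos] at h1
  simp only [nsmul_eq_mul] at h1
  rw [← h1]
  refine Finset.sum_nbij' (fun S => S.erase u) (fun S => insert u S) ?_ ?_ ?_ ?_ ?_
  · intro S hS
    rw [Finset.mem_filter, Finset.mem_powerset] at hS
    exact Finset.mem_powerset.mpr (Finset.erase_subset_erase u hS.1)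
  · intro S hS
    rw [Finset.mem_powerset] at hS
    rw [Finset.mem_filter, Finset.mem_powerset]
    exact ⟨Finset.insert_subset hu (hS.trans (Finset.erase_subset u U)), Finset.mem_insert_self u S⟩
  · intro S hS
    exact Finset.insert_erase (Finset.mem_filter.mp hS).2
  · intro S hS
    exact Finset.erase_insert fun h => Finset.notMem_erase u U (Finset.mem_powerset.mp hS h)
  · intro S hS
    rw [Finset.card_erase_add_one (Finset.mem_filter.mp hS).2]

/-- After division by the factorials, the choice of the row set through `u` and of the column set
cancels against the block counts, and the recursion on blocks becomes the logarithmic-derivative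
recursion of `expCoeff`. -/
theorem card_boundedSquares (k N : ℕ) : ∀ U V : Finset (Fin n), U.card = N → V.card = N →
    ((boundedSquares k U V).card : ℝ) = (N.factorial : ℝ) ^ 2 * expCoeff (weightUpTo k) N := by
  induction N using Nat.strong_induction_on with
  | _ N ih =>
  intro U V hU hV
  rcases N with _ | N
  · rw [Finset.card_eq_zero] at hU hV
    rw [hU, hV, boundedSquares_empty, expCoeff_zero]
    simp
  obtain ⟨u, hu⟩ : U.Nonempty := Finset.card_pos.mp (by omega)
  have hinner : ∀ S ∈ U.powerset.filter (u ∈ ·), ∀ T ∈ V.powersetCard S.card,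
      ((if S.card ≤ k then (irreducibleSquares S T).card * (boundedSquares k (U \ S) (V \ T)).card
        else 0 : ℕ) : ℝ) = S.card.factorial * (S.card - 1).factorial *
          ((N + 1 - S.card).factorial : ℝ) ^ 2 *
            (weightUpTo k (S.card - 1) * expCoeff (weightUpTo k) (N + 1 - S.card)) := by
    intro S hS T hT
    rw [Finset.mem_filter, Finset.mem_powerset] at hS
    rw [Finset.mem_powersetCard] at hT
    have hpos : 0 < S.card := Finset.card_pos.mpr ⟨u, hS.2⟩
    have c1 : (U \ S).card = N + 1 - S.card := by rw [Finset.card_sdiff_of_subset hS.1, hU]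
    have c2 : (V \ T).card = N + 1 - S.card := by rw [Finset.card_sdiff_of_subset hT.1, hV, hT.2]
    split_ifs with hk
    · rw [Nat.cast_mul, ih _ (by omega) _ _ c1 c2, card_irreducibleSquares_eq ⟨u, hS.2⟩ hT.2.symm,
        weightUpTo, if_pos (by omega)]
      ring
    · rw [weightUpTo, if_neg (by omega)]
      simp
  rw [card_boundedSquares_eq_sum hu, Nat.cast_sum]
  simp_rw [Nat.cast_sum]
  rw [Finset.sum_congr rfl fun S hS => (Finset.sum_congr rfl (hinner S hS)).trans
    (Finset.sum_const _)]
  simp only [Finset.card_powersetCard, nsmul_eq_mul]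
  rw [sum_powerset_mem_apply_card hu (fun c => (V.card.choose c : ℝ) * (c.factorial *
    (c - 1).factorial * ((N + 1 - c).factorial : ℝ) ^ 2 *
      (weightUpTo k (c - 1) * expCoeff (weightUpTo k) (N + 1 - c)))), hU, hV]
  -- The asymmetric split N! (N+1)! (N+1) matches the two binomials: N choose i for rows, since `u`
  -- is prescribed, and N+1 choose i+1 for columns.
  have hstep : ((N + 1).factorial : ℝ) ^ 2 * expCoeff (weightUpTo k) (N + 1) =
      N.factorial * (N + 1).factorial * ((N + 1) * expCoeff (weightUpTo k) (N + 1)) := by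
    rw [Nat.factorial_succ]
    push_cast
    ring
  rw [hstep, expCoeff_succ, Finset.mul_sum]
  refine Finset.sum_congr rfl fun i hi => ?_
  have hi' : i ≤ N := by simpa [Nat.lt_succ_iff] using hi
  have e1 : N + 1 - (i + 1) = N - i := by omega
  have f1 : (N.choose i * i.factorial * (N - i).factorial : ℝ) = N.factorial := by
    exact_mod_cast Nat.choose_mul_factorial_mul_factorial hi'
  have f2 : ((N + 1).choose (i + 1) * (i + 1).factorial * (N - i).factorial : ℝ) =
      (N + 1).factorial := by
    have := Nat.choose_mul_factorial_mul_factorial (Nat.succ_le_succ hi')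
    rw [Nat.succ_eq_add_one, Nat.succ_eq_add_one, e1] at this
    exact_mod_cast this
  rw [← f1, ← f2, e1, Nat.add_sub_cancel, Nat.add_sub_cancel]
  ring

end Counting

/-! ### Translation to magical squares and the largest component -/

section Magical

variable {n : ℕ}

theorem mem_magicalSquares_iff {A : Matrix (Fin n) (Fin n) ℕ} :
    A ∈ magicalSquares n 2 ↔ IsSquareOn Finset.univ Finset.univ A :=
  ⟨fun h => ⟨fun _ _ _ => by simp, fun i _ => h.1 i, fun j _ => h.2 j⟩,
    fun h => ⟨fun i => h.row_sum i (Finset.mem_univ i), fun j => h.col_sum j (Finset.mem_univ j)⟩⟩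

theorem finite_magicalSquares (n : ℕ) : (magicalSquares n 2).Finite :=
  (finite_isSquareOn Finset.univ Finset.univ).subset fun _ h => mem_magicalSquares_iff.mp h

theorem componentCount_pos_iff {r : ℕ} {A : Matrix (Fin n) (Fin n) ℕ} {k : ℕ} :
    0 < componentCount r A k ↔ ∃ S T, IsIrreducibleComponent r A S T ∧ S.card = k := by
  rw [componentCount, Set.ncard_pos]
  exact ⟨fun ⟨p, hp⟩ => ⟨p.1, p.2, hp⟩, fun ⟨S, T, h⟩ => ⟨(S, T), h⟩⟩

theorem largestComponent_le_iff {r : ℕ} {A : Matrix (Fin n) (Fin n) ℕ} {k : ℕ} :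
    largestComponent r A ≤ k ↔ ∀ S T, IsIrreducibleComponent r A S T → S.card ≤ k := by
  have hset : {j : ℕ | 1 ≤ j ∧ 0 < componentCount r A j} =
      {j | ∃ S T, IsIrreducibleComponent r A S T ∧ S.card = j} := by
    ext j
    simp only [componentCount_pos_iff, Set.mem_ofPred_eq]
    refine ⟨fun h => h.2, fun h => ⟨?_, h⟩⟩
    obtain ⟨S, T, h, rfl⟩ := h
    exact h.1.rows_nonempty.card_pos
  have hb : BddAbove {j | ∃ S T, IsIrreducibleComponent r A S T ∧ S.card = j} := by
    refine ⟨n, ?_⟩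
    rintro j ⟨S, T, -, rfl⟩
    simpa using S.card_le_univ
  rw [largestComponent, hset]
  constructor
  · intro h S T hST
    exact (le_csSup hb ⟨S, T, hST, rfl⟩).trans h
  · intro h
    exact csSup_le' (by rintro j ⟨S, T, hST, rfl⟩; exact h S T hST)

theorem largestComponent_le {r : ℕ} (A : Matrix (Fin n) (Fin n) ℕ) : largestComponent r A ≤ n :=
  largestComponent_le_iff.mpr fun S _ _ => by simpa using S.card_le_univ

theorem ncard_largestComponent_le (n k : ℕ) :
    ((magicalSquares n 2 ∩ {A | largestComponent 2 A ≤ k}).ncard : ℝ) =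
      (n.factorial : ℝ) ^ 2 * expCoeff (weightUpTo k) n := by
  rw [← card_boundedSquares k n (Finset.univ : Finset (Fin n)) Finset.univ (by simp) (by simp),
    ← Set.ncard_coe_finset]
  congr 2
  ext A
  simp only [Set.mem_inter_iff, Set.mem_ofPred_eq, Finset.mem_coe, mem_boundedSquares,
    mem_magicalSquares_iff, largestComponent_le_iff]

theorem expCoeff_congr {e e' : ℕ → ℝ} : ∀ {n : ℕ}, (∀ j < n, e j = e' j) →
    expCoeff e n = expCoeff e' n := by
  intro n
  induction n using Nat.strong_induction_on with
  | _ n ih =>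
  intro h
  rcases n with _ | n
  · rw [expCoeff_zero, expCoeff_zero]
  · have h1 := expCoeff_succ e n
    rw [Finset.sum_congr rfl fun i hi => by
      rw [h i (by simpa using hi), ih (n - i) (by omega) fun j hj => h j (by omega)],
      ← expCoeff_succ e' n] at h1
    exact mul_left_cancel₀ (by positivity) h1

theorem expCoeff_weightUpTo_of_le {n k : ℕ} (h : n ≤ k) :
    expCoeff (weightUpTo k) n = expCoeff weight n :=
  expCoeff_congr fun j hj => by rw [weightUpTo, if_pos (by omega)]

theorem ncard_magicalSquares (n : ℕ) :
    ((magicalSquares n 2).ncard : ℝ) = (n.factorial : ℝ) ^ 2 * expCoeff weight n := by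
  rw [← expCoeff_weightUpTo_of_le le_rfl, ← ncard_largestComponent_le]
  congr 2
  exact (Set.inter_eq_left.mpr fun A _ => largestComponent_le A).symm

end Magical

/-! ### Generating functions inside the unit disc -/

section Series

theorem hasDerivAt_tsum_mul_pow {c : ℕ → ℝ} (hc : ∀ n, |c n| ≤ 1) {x : ℝ} (hx : |x| < 1) :
    HasDerivAt (fun y => ∑' n, c n * y ^ n) (∑' n : ℕ, (n + 1) * c (n + 1) * x ^ n) x := by
  obtain ⟨r, hxr, hr1⟩ := exists_between hx
  have hr0 : 0 < r := (abs_nonneg x).trans_lt hxr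
  have hsum : Summable fun n : ℕ => (n : ℝ) * r ^ (n - 1) := by
    have h := summable_pow_mul_geometric_of_norm_lt_one 1 (r := r)
      (by rwa [Real.norm_of_nonneg hr0.le])
    refine (h.mul_right r⁻¹).congr fun n => ?_
    rcases n with _ | n
    · simp
    · rw [Nat.add_sub_cancel, pow_one, pow_succ]
      field_simp
  have hmem : x ∈ Metric.ball (0 : ℝ) r := by simpa using hxr
  have h := hasDerivAt_tsum_of_isPreconnected (g := fun n y => c n * y ^ n)
    (g' := fun n y => c n * (n * y ^ (n - 1))) (t := Metric.ball (0 : ℝ) r) (y₀ := 0) (y := x)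
    hsum Metric.isOpen_ball (convex_ball (0 : ℝ) r).isPreconnected
    (fun n y _ => (hasDerivAt_pow n y).const_mul (c n)) ?_ (by simpa using hr0) ?_ hmem
  · refine h.congr_deriv ?_
    rw [Summable.tsum_eq_zero_add]
    · simp only [Nat.cast_zero, zero_mul, mul_zero, zero_add, Nat.add_sub_cancel]
      exact tsum_congr fun n => by push_cast; ring
    · refine hsum.of_norm_bounded fun n => ?_
      rw [norm_mul, norm_mul, norm_pow, Real.norm_eq_abs, Real.norm_eq_abs, Real.norm_eq_abs,
        Nat.abs_cast]
      calc |c n| * (n * |x| ^ (n - 1)) ≤ 1 * (n * r ^ (n - 1)) := by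
            gcongr
            exact hc n
        _ = n * r ^ (n - 1) := one_mul _
  · intro n y hy
    have hy' : |y| < r := by simpa using hy
    rw [norm_mul, norm_mul, norm_pow, Real.norm_eq_abs, Real.norm_eq_abs, Real.norm_eq_abs,
      Nat.abs_cast]
    calc |c n| * (n * |y| ^ (n - 1)) ≤ 1 * (n * r ^ (n - 1)) := by
          gcongr
          exact hc n
      _ = n * r ^ (n - 1) := one_mul _
  · refine summable_of_ne_finset_zero (s := {0}) fun n hn => ?_
    have : n ≠ 0 := by simpa using hn
    simp [this]

theorem summable_mul_pow {c : ℕ → ℝ} (hc : ∀ n, |c n| ≤ 1) {x : ℝ} (hx : |x| < 1) :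
    Summable fun n => ‖c n * x ^ n‖ := by
  refine (summable_geometric_of_lt_one (abs_nonneg x) hx).of_nonneg_of_le
    (fun _ => norm_nonneg _) fun n => ?_
  rw [norm_mul, norm_pow, Real.norm_eq_abs, Real.norm_eq_abs]
  exact mul_le_of_le_one_left (by positivity) (hc n)

variable {e : ℕ → ℝ}

theorem expCoeff_nonneg (h0 : ∀ j, 0 ≤ e j) (n : ℕ) : 0 ≤ expCoeff e n := by
  induction n using Nat.strong_induction_on with
  | _ n ih =>
  rcases n with _ | n
  · rw [expCoeff_zero]; exact zero_le_one
  · have h := expCoeff_succ e n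
    have : 0 ≤ (n + 1) * expCoeff e (n + 1) := by
      rw [h]
      exact Finset.sum_nonneg fun i _ => mul_nonneg (h0 i) (ih _ (by omega))
    exact nonneg_of_mul_nonneg_right this (by positivity)

theorem expCoeff_le_one (h0 : ∀ j, 0 ≤ e j) (h1 : ∀ j, e j ≤ 1) (n : ℕ) : expCoeff e n ≤ 1 := by
  induction n using Nat.strong_induction_on with
  | _ n ih =>
  rcases n with _ | n
  · rw [expCoeff_zero]
  · have h := expCoeff_succ e n
    have : (n + 1) * expCoeff e (n + 1) ≤ (n + 1) * 1 := by
      rw [h]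
      calc _ ≤ ∑ i ∈ Finset.range (n + 1), (1 : ℝ) := Finset.sum_le_sum fun i _ =>
            mul_le_one₀ (h1 i) (expCoeff_nonneg h0 _) (ih _ (by omega))
        _ = _ := by simp
    exact le_of_mul_le_mul_left this (by positivity)

theorem abs_expCoeff_le_one (h0 : ∀ j, 0 ≤ e j) (h1 : ∀ j, e j ≤ 1) (n : ℕ) :
    |expCoeff e n| ≤ 1 := by
  rw [abs_of_nonneg (expCoeff_nonneg h0 n)]
  exact expCoeff_le_one h0 h1 n

/-- Let F be the series and P the exponent. The recursion, read as a Cauchy product, says F' = P' F,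
so F e^{-P} has zero derivative and equals its value 1 at the origin. -/
theorem hasSum_expCoeff (h0 : ∀ j, 0 ≤ e j) (h1 : ∀ j, e j ≤ 1) {x : ℝ} (hx : |x| < 1) :
    HasSum (fun n => expCoeff e n * x ^ n) (Real.exp (∑' j : ℕ, e j / (j + 1) * x ^ (j + 1))) := by
  have hq := abs_expCoeff_le_one h0 h1
  have he : ∀ j, |e j| ≤ 1 := fun j => by rw [abs_of_nonneg (h0 j)]; exact h1 j
  set p : ℕ → ℝ := fun n => if n = 0 then 0 else e (n - 1) / n with hp
  have hp1 : ∀ n, |p n| ≤ 1 := fun n => by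
    rcases n with _ | n
    · simp [hp]
    · simp only [hp, Nat.succ_ne_zero, if_false, Nat.add_sub_cancel]
      rw [abs_div, Nat.abs_cast, div_le_one (by positivity)]
      refine (he n).trans ?_
      push_cast
      linarith [(Nat.cast_nonneg n : (0 : ℝ) ≤ n)]
  have hps : ∀ n : ℕ, (n + 1) * p (n + 1) = e n := fun n => by
    simp only [hp, Nat.succ_ne_zero, if_false, Nat.add_sub_cancel]
    push_cast
    field_simp
  set F : ℝ → ℝ := fun y => ∑' n, expCoeff e n * y ^ n with hF
  set P : ℝ → ℝ := fun y => ∑' n, p n * y ^ n with hP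
  have hP' : ∀ y, |y| < 1 → P y = ∑' j : ℕ, e j / (j + 1) * y ^ (j + 1) := fun y hy => by
    rw [hP]
    simp only
    rw [(summable_mul_pow hp1 hy).of_norm.tsum_eq_zero_add]
    simp [hp]
  have hderiv : ∀ y, |y| < 1 → HasDerivAt (fun y => F y * Real.exp (-P y)) 0 y := fun y hy => by
    have d1 : HasDerivAt F ((∑' n, e n * y ^ n) * F y) y := by
      refine (hasDerivAt_tsum_mul_pow hq hy).congr_deriv ?_
      rw [hF]
      simp only
      rw [tsum_mul_tsum_eq_tsum_sum_antidiagonal_of_summable_norm (summable_mul_pow he hy)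
        (summable_mul_pow hq hy)]
      refine tsum_congr fun n => ?_
      rw [expCoeff_succ, Finset.Nat.sum_antidiagonal_eq_sum_range_succ
        (fun i j => e i * y ^ i * (expCoeff e j * y ^ j)), Finset.sum_mul]
      refine Finset.sum_congr rfl fun i hi => ?_
      have hi' : i ≤ n := by simpa [Nat.lt_succ_iff] using hi
      conv_lhs => rw [← Nat.add_sub_cancel' hi', pow_add, Nat.add_sub_cancel' hi']
      ring
    have d2 : HasDerivAt P (∑' n, e n * y ^ n) y := by
      refine (hasDerivAt_tsum_mul_pow hp1 hy).congr_deriv ?_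
      simp only [hps]
    refine (d1.mul d2.neg.exp).congr_deriv ?_
    ring
  have hconst : F x * Real.exp (-P x) = F 0 * Real.exp (-P 0) := by
    have hball : ∀ y, y ∈ Metric.ball (0 : ℝ) 1 ↔ |y| < 1 := fun y => by simp
    refine Metric.isOpen_ball.is_const_of_deriv_eq_zero (𝕜 := ℝ) (s := Metric.ball (0 : ℝ) 1)
      (convex_ball (0 : ℝ) 1).isPreconnected
      (fun y hy => (hderiv y ((hball y).mp hy)).differentiableAt.differentiableWithinAt)
      (fun y hy => (hderiv y ((hball y).mp hy)).deriv) ((hball x).mpr hx) ((hball 0).mpr (by simp))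
  have hF0 : F 0 = 1 := by
    rw [hF]
    simp only
    rw [tsum_eq_single 0 (fun n hn => by simp [hn])]
    simp [expCoeff_zero]
  have hP0 : P 0 = 0 := by
    rw [hP' 0 (by simp)]
    simp
  rw [hF0, hP0, neg_zero, Real.exp_zero, mul_one, Real.exp_neg, ← div_eq_mul_inv,
    div_eq_one_iff_eq (Real.exp_pos _).ne', hP' x hx] at hconst
  rw [← hconst]
  exact (summable_mul_pow hq hx).of_norm.hasSum

end Series

/-! ### Monotonicity in the dimension -/

section Monotonicity

theorem weight_nonneg (j : ℕ) : 0 ≤ weight j := by unfold weight; split_ifs <;> norm_num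

theorem weight_le_one (j : ℕ) : weight j ≤ 1 := by unfold weight; split_ifs <;> norm_num

theorem weightUpTo_nonneg (k j : ℕ) : 0 ≤ weightUpTo k j := by
  unfold weightUpTo; split_ifs
  exacts [weight_nonneg j, le_rfl]

theorem weightUpTo_le_one (k j : ℕ) : weightUpTo k j ≤ 1 := by
  unfold weightUpTo; split_ifs
  exacts [weight_le_one j, zero_le_one]

/-- The difference of two consecutive recursions involves only increments of `e`. For `weight` a
single increment is non-zero, which leaves a three-term recurrence. -/
theorem expCoeff_second_difference (e : ℕ → ℝ) (n : ℕ) :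
    (n + 2) * expCoeff e (n + 2) = (n + 1) * expCoeff e (n + 1) + e 0 * expCoeff e (n + 1) +
      ∑ i ∈ Finset.range (n + 1), (e (i + 1) - e i) * expCoeff e (n - i) := by
  have h1 := expCoeff_succ e n
  have h2 := expCoeff_succ e (n + 1)
  rw [Finset.sum_range_succ'] at h2
  simp only [Nat.add_sub_add_right, Nat.sub_zero] at h2
  simp only [sub_mul, Finset.sum_sub_distrib]
  rw [← h1]
  push_cast at h2
  linarith

theorem expCoeff_weight_succ_succ (n : ℕ) :
    (n + 2) * expCoeff weight (n + 2) =
      (n + 2) * expCoeff weight (n + 1) - 1 / 2 * expCoeff weight n := by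
  rw [expCoeff_second_difference, Finset.sum_range_succ', Finset.sum_eq_zero]
  · simp [weight]
    ring
  · intro i _
    simp [weight]

/-- Truncated weights still decrease, and their first drop is at least 1/2, so the recurrence of the
untruncated sequence survives as an inequality. The first weight has to be 1, which excludes k = 0.
-/
theorem expCoeff_weightUpTo_succ_succ_le {k : ℕ} (hk : 1 ≤ k) (n : ℕ) :
    (n + 2) * expCoeff (weightUpTo k) (n + 2) ≤
      (n + 2) * expCoeff (weightUpTo k) (n + 1) - 1 / 2 * expCoeff (weightUpTo k) n := by
  have hnn := expCoeff_nonneg (weightUpTo_nonneg k)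
  have h0 : weightUpTo k 0 = 1 := by simp [weightUpTo, weight, Nat.lt_of_lt_of_le Nat.zero_lt_one hk]
  have h1 : weightUpTo k 1 ≤ 1 / 2 := by
    unfold weightUpTo weight
    split_ifs <;> norm_num at *
  have hmono : ∀ i, weightUpTo k (i + 1 + 1) ≤ weightUpTo k (i + 1) := fun i => by
    unfold weightUpTo weight
    split_ifs <;> first | omega | norm_num
  rw [expCoeff_second_difference, Finset.sum_range_succ']
  have h2 : ∑ i ∈ Finset.range n, (weightUpTo k (i + 1 + 1) - weightUpTo k (i + 1)) *
      expCoeff (weightUpTo k) (n - (i + 1)) ≤ 0 :=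
    Finset.sum_nonpos fun i _ => mul_nonpos_of_nonpos_of_nonneg (sub_nonpos.mpr (hmono i)) (hnn _)
  have h3 := hnn n
  rw [h0, zero_add, Nat.sub_zero]
  nlinarith

theorem expCoeff_weight_pos (n : ℕ) : 0 < expCoeff weight n := by
  induction n with
  | zero => rw [expCoeff_zero]; exact zero_lt_one
  | succ n ih =>
    have h := expCoeff_succ weight n
    have h2 : expCoeff weight n ≤ ∑ i ∈ Finset.range (n + 1), weight i * expCoeff weight (n - i) := by
      have := Finset.single_le_sum (f := fun i => weight i * expCoeff weight (n - i))
        (fun i _ => mul_nonneg (weight_nonneg i) (expCoeff_nonneg weight_nonneg _))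
        (Finset.mem_range.mpr (Nat.succ_pos n))
      simpa [weight] using this
    have h3 : 0 < (n + 1) * expCoeff weight (n + 1) := by rw [h]; linarith
    exact pos_of_mul_pos_right h3 (by positivity)

/-- The proportion of squares whose components all have size at most `k` decreases with the
dimension. -/
theorem expCoeff_ratio_succ_le (k n : ℕ) :
    expCoeff (weightUpTo k) (n + 1) / expCoeff weight (n + 1) ≤
      expCoeff (weightUpTo k) n / expCoeff weight n := by
  rw [div_le_div_iff₀ (expCoeff_weight_pos _) (expCoeff_weight_pos _)]
  have hnn := expCoeff_nonneg (weightUpTo_nonneg k)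
  rcases Nat.eq_zero_or_pos k with rfl | hk
  · have h := expCoeff_succ (weightUpTo 0) n
    have h0 : ∀ j, weightUpTo 0 j = 0 := fun j => by simp [weightUpTo]
    simp only [h0, zero_mul, Finset.sum_const_zero] at h
    have h1 : expCoeff (weightUpTo 0) (n + 1) = 0 :=
      (mul_eq_zero.mp h).resolve_left (by positivity)
    rw [h1, zero_mul]
    exact mul_nonneg (hnn n) (expCoeff_weight_pos _).le
  · induction n with
    | zero =>
      have h1 := expCoeff_succ (weightUpTo k) 0
      have h2 := expCoeff_succ weight 0
      simp [expCoeff_zero, weightUpTo, weight, hk] at h1 h2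
      rw [zero_add, h1, h2, expCoeff_zero, expCoeff_zero]
    | succ n ih =>
      have h1 := expCoeff_weightUpTo_succ_succ_le hk n
      have h2 := expCoeff_weight_succ_succ n
      have ha := (expCoeff_weight_pos (n + 1)).le
      -- Once the two recurrences are inserted, what is left is half of the induction hypothesis
      -- q_k(n+1) q(n) ≤ q_k(n) q(n+1).
      have key : (n + 2 : ℝ) * (expCoeff (weightUpTo k) (n + 2) * expCoeff weight (n + 1)) ≤
          (n + 2) * (expCoeff (weightUpTo k) (n + 1) * expCoeff weight (n + 2)) := by
        calc (n + 2 : ℝ) * (expCoeff (weightUpTo k) (n + 2) * expCoeff weight (n + 1))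
            = ((n + 2) * expCoeff (weightUpTo k) (n + 2)) * expCoeff weight (n + 1) := by ring
          _ ≤ ((n + 2) * expCoeff (weightUpTo k) (n + 1) - 1 / 2 * expCoeff (weightUpTo k) n) *
                expCoeff weight (n + 1) := mul_le_mul_of_nonneg_right h1 ha
          _ ≤ expCoeff (weightUpTo k) (n + 1) *
                ((n + 2) * expCoeff weight (n + 1) - 1 / 2 * expCoeff weight n) := by linarith
          _ = _ := by rw [← h2]; ring
      exact le_of_mul_le_mul_left key (by positivity)

theorem expCoeff_ratio_antitone (k : ℕ) :
    Antitone fun n => expCoeff (weightUpTo k) n / expCoeff weight n :=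
  antitone_nat_of_succ_le (expCoeff_ratio_succ_le k)

theorem expCoeff_weightUpTo_le (k n : ℕ) : expCoeff (weightUpTo k) n ≤ expCoeff weight n := by
  have h := expCoeff_ratio_antitone k (Nat.zero_le n)
  simp only [expCoeff_zero, div_one] at h
  rwa [div_le_one (expCoeff_weight_pos n)] at h

theorem expCoeff_weight_le_two_mul (n : ℕ) : expCoeff weight n ≤ 2 * expCoeff weight (n + 1) := by
  induction n with
  | zero =>
    have h2 := expCoeff_succ weight 0
    simp [expCoeff_zero, weight] at h2
    rw [zero_add, h2, expCoeff_zero]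
    norm_num
  | succ n ih =>
    have h2 := expCoeff_weight_succ_succ n
    have hp := expCoeff_weight_pos (n + 1)
    have hn : (0 : ℝ) ≤ n := Nat.cast_nonneg n
    have h3 : (n + 2 : ℝ) * expCoeff weight (n + 1) ≤ (n + 2) * (2 * expCoeff weight (n + 2)) := by
      nlinarith
    exact le_of_mul_le_mul_left h3 (by positivity)

/-- By the recurrence, the increment from n+1 to n+2 is q(n+1) - q(n)/2. This substitutes for the
asymptotics of q in the bound below. -/
theorem mul_expCoeff_weight_monotone : Monotone fun n : ℕ => n * expCoeff weight n := by
  refine monotone_nat_of_le_succ fun n => ?_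
  rcases n with _ | n
  · simpa using (expCoeff_weight_pos 1).le
  · have h2 := expCoeff_weight_succ_succ n
    have h3 := expCoeff_weight_le_two_mul n
    push_cast
    have : (n + 1 + 1 : ℝ) = n + 2 := by ring
    rw [this, h2]
    linarith

/-- At most k terms of the recursion survive. Each is at most q(m-i) with m-i ≥ n/2, hence at most 2
q(n) because n q(n) increases. This is the estimate that prevents mass of the limit law at 0. -/
theorem expCoeff_ratio_le {k n : ℕ} (hn : 0 < n) (h : 2 * k ≤ n) :
    expCoeff (weightUpTo k) n / expCoeff weight n ≤ 2 * k / n := by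
  rw [div_le_div_iff₀ (expCoeff_weight_pos n) (by exact_mod_cast hn)]
  obtain ⟨m, rfl⟩ : ∃ m, n = m + 1 := ⟨n - 1, by omega⟩
  have h1 := expCoeff_succ (weightUpTo k) m
  have hle : ∀ i ∈ Finset.range (m + 1), weightUpTo k i * expCoeff (weightUpTo k) (m - i) ≤
      if i < k then 2 * expCoeff weight (m + 1) else 0 := by
    intro i _
    split_ifs with hi
    · have h2 : weightUpTo k i * expCoeff (weightUpTo k) (m - i) ≤ expCoeff weight (m - i) :=
        (mul_le_of_le_one_left (expCoeff_nonneg (weightUpTo_nonneg k) _)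
          (weightUpTo_le_one k i)).trans (expCoeff_weightUpTo_le k _)
      have h3 := mul_expCoeff_weight_monotone (show m - i ≤ m + 1 by omega)
      simp only at h3
      have h4 : ((m + 1 : ℕ) : ℝ) ≤ 2 * ((m - i : ℕ) : ℝ) := by
        norm_cast
        omega
      have h5 := expCoeff_weight_pos (m - i)
      have h6 : ((m + 1 : ℕ) : ℝ) * expCoeff weight (m - i) ≤
          ((m + 1 : ℕ) : ℝ) * (2 * expCoeff weight (m + 1)) := by nlinarith
      exact h2.trans (le_of_mul_le_mul_left h6 (by positivity))
    · simp [weightUpTo, hi]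
  have h2 := Finset.sum_le_sum hle
  rw [← h1, ← Finset.sum_filter, Finset.sum_const, nsmul_eq_mul] at h2
  have h3 : (((Finset.range (m + 1)).filter (· < k)).card : ℝ) ≤ k := by
    have : (Finset.range (m + 1)).filter (· < k) ⊆ Finset.range k := fun i hi => by
      simpa using (Finset.mem_filter.mp hi).2
    simpa using (Nat.cast_le (α := ℝ)).mpr (Finset.card_le_card this)
  have h4 := expCoeff_weight_pos (m + 1)
  push_cast
  nlinarith

end Monotonicity

/-! ### The exponential integral and integration by parts -/

section ExpIntegral

theorem expIntegralE1_nonneg {u : ℝ} (hu : 0 < u) : 0 ≤ expIntegralE1 u :=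
  setIntegral_nonneg measurableSet_Ioi fun v hv => by
    have : 0 < v := hu.trans hv
    positivity

theorem expIntegralE1_sub {a b : ℝ} (ha : 0 < a) (hab : a ≤ b) :
    expIntegralE1 a - expIntegralE1 b = ∫ v in a..b, Real.exp (-v) / v := by
  have h := intervalIntegral.integral_interval_add_Ioi (integrableOn_expIntegralE1 ha)
    (integrableOn_expIntegralE1 (ha.trans_le hab))
  rw [expIntegralE1, expIntegralE1, ← h]
  ring

theorem intervalIntegrable_exp_neg_div {a b : ℝ} (ha : 0 < a) (hab : a ≤ b) :
    IntervalIntegrable (fun v : ℝ => Real.exp (-v) / v) volume a b := by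
  refine ContinuousOn.intervalIntegrable ?_
  rw [uIcc_of_le hab]
  exact ContinuousOn.div (by fun_prop) continuousOn_id fun v hv => (ha.trans_le hv.1).ne'

theorem le_expIntegralE1_sub {a b : ℝ} (ha : 0 < a) (hab : a ≤ b) :
    (b - a) * (Real.exp (-b) / b) ≤ expIntegralE1 a - expIntegralE1 b := by
  rw [expIntegralE1_sub ha hab, ← smul_eq_mul, ← intervalIntegral.integral_const]
  refine intervalIntegral.integral_mono_on hab (by simp) (intervalIntegrable_exp_neg_div ha hab)
    fun v hv => ?_
  have : 0 < v := ha.trans_le hv.1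
  have := hv.2
  gcongr

theorem expIntegralE1_sub_le {a b : ℝ} (ha : 0 < a) (hab : a ≤ b) :
    expIntegralE1 a - expIntegralE1 b ≤ (b - a) * (Real.exp (-a) / a) := by
  rw [expIntegralE1_sub ha hab, ← smul_eq_mul, ← intervalIntegral.integral_const]
  refine intervalIntegral.integral_mono_on hab (intervalIntegrable_exp_neg_div ha hab) (by simp)
    fun v hv => ?_
  have := hv.1
  gcongr

theorem expIntegralE1_le {u : ℝ} (hu : 0 < u) : expIntegralE1 u ≤ Real.exp (-u) / u := by
  have h : ∫ v in Ioi u, Real.exp (-v) / u = Real.exp (-u) / u := by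
    rw [integral_div, integral_exp_neg_Ioi]
  rw [← h]
  refine setIntegral_mono_on (integrableOn_expIntegralE1 hu)
    ((integrableOn_exp_neg_Ioi u).div_const u) measurableSet_Ioi fun v hv => ?_
  have hv' : u < v := hv
  have hv0 : 0 < v := hu.trans hv'
  gcongr

theorem tendsto_expIntegralE1_atTop : Tendsto expIntegralE1 atTop (𝓝 0) := by
  have h : Tendsto (fun u : ℝ => Real.exp (-u)) atTop (𝓝 0) :=
    Real.tendsto_exp_atBot.comp tendsto_neg_atTop_atBot
  refine tendsto_of_tendsto_of_tendsto_of_le_of_le' tendsto_const_nhds h ?_ ?_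
  · filter_upwards [eventually_gt_atTop 0] with u hu using expIntegralE1_nonneg hu
  · filter_upwards [eventually_ge_atTop 1] with u hu
    refine (expIntegralE1_le (by linarith)).trans (div_le_self (Real.exp_pos _).le hu)

theorem hasDerivAt_expIntegralE1 {u : ℝ} (hu : 0 < u) :
    HasDerivAt expIntegralE1 (-(Real.exp (-u) / u)) u := by
  have hc : 0 < u / 2 := by linarith
  have h1 : HasDerivAt (fun w => ∫ v in (u / 2)..w, Real.exp (-v) / v) (Real.exp (-u) / u) u := by
    refine intervalIntegral.integral_hasDerivAt_right
      (intervalIntegrable_exp_neg_div hc (by linarith)) ?_ ?_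
    · exact (by fun_prop : Measurable fun v : ℝ => Real.exp (-v) / v).stronglyMeasurable.stronglyMeasurableAtFilter
    · exact ContinuousAt.div (by fun_prop) continuousAt_id hu.ne'
  refine (h1.const_sub (expIntegralE1 (u / 2))).congr_of_eventuallyEq ?_
  filter_upwards [lt_mem_nhds (show u / 2 < u by linarith)] with w hw
  rw [← expIntegralE1_sub hc hw.le]
  ring

theorem continuousOn_expIntegralE1 : ContinuousOn expIntegralE1 (Ioi 0) :=
  fun _ hu => (hasDerivAt_expIntegralE1 hu).continuousAt.continuousWithinAt

theorem continuousOn_momentIntegrand (m : ℕ) : ContinuousOn (momentIntegrand m) (Ioi 0) := by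
  have := continuousOn_expIntegralE1
  unfold momentIntegrand
  fun_prop

theorem momentIntegrand_nonneg (m : ℕ) {u : ℝ} (hu : 0 < u) : 0 ≤ momentIntegrand m u := by
  unfold momentIntegrand
  positivity

theorem momentIntegrand_le (m : ℕ) {u : ℝ} (hu : 0 < u) :
    momentIntegrand m u ≤ Real.exp (-u) * u ^ (m - 1) := by
  have := expIntegralE1_nonneg hu
  unfold momentIntegrand
  gcongr
  linarith

theorem integrableOn_exp_neg_mul_pow (m : ℕ) :
    IntegrableOn (fun u : ℝ => Real.exp (-u) * u ^ m) (Ioi 0) := by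
  refine (Real.GammaIntegral_convergent (s := (m : ℝ) + 1) (by positivity)).congr_fun
    (fun u _ => ?_) measurableSet_Ioi
  simp

theorem integrableOn_momentIntegrand (m : ℕ) : IntegrableOn (momentIntegrand m) (Ioi 0) := by
  refine Integrable.mono' (integrableOn_exp_neg_mul_pow (m - 1))
    ((continuousOn_momentIntegrand m).aestronglyMeasurable measurableSet_Ioi) ?_
  filter_upwards [ae_restrict_mem measurableSet_Ioi] with u hu
  rw [Real.norm_of_nonneg (momentIntegrand_nonneg m hu)]
  exact momentIntegrand_le m hu

/-- The integrand of the `m`-th moment integral of the tail `1 - exp (-E₁(u)/2)`. -/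
noncomputable def tailIntegrand (m : ℕ) (u : ℝ) : ℝ :=
  m * u ^ (m - 1) * (1 - Real.exp (-(1 / 2 * expIntegralE1 u)))

/-- The constant 2 is generous so that the same majorant also serves the discretised tail in
`one_sub_exp_neg_tailLog_floor_le`. -/
theorem one_sub_exp_neg_expIntegralE1_le {u : ℝ} (hu : 0 < u) :
    1 - Real.exp (-(1 / 2 * expIntegralE1 u)) ≤ Real.exp (2 - u) := by
  rcases le_total u 2 with h | h
  · have h1 : 1 ≤ Real.exp (2 - u) := Real.one_le_exp (by linarith)
    have h2 := Real.exp_pos (-(1 / 2 * expIntegralE1 u))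
    linarith
  · have h1 := Real.add_one_le_exp (-(1 / 2 * expIntegralE1 u))
    have h2 := expIntegralE1_le hu
    have h3 := expIntegralE1_nonneg hu
    have h4 : Real.exp (-u) / u ≤ Real.exp (-u) := div_le_self (Real.exp_pos _).le (by linarith)
    have h5 : Real.exp (-u) ≤ Real.exp (2 - u) := Real.exp_le_exp.mpr (by linarith)
    linarith

theorem integrableOn_pow_mul_exp (m : ℕ) :
    IntegrableOn (fun u : ℝ => m * u ^ (m - 1) * Real.exp (2 - u)) (Ioi 0) := by
  have h : IntegrableOn (fun u : ℝ => m * Real.exp 2 * (Real.exp (-u) * u ^ (m - 1))) (Ioi 0) :=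
    (integrableOn_exp_neg_mul_pow (m - 1)).const_mul (m * Real.exp 2)
  refine h.congr_fun (fun u _ => ?_) measurableSet_Ioi
  simp only
  rw [sub_eq_add_neg, Real.exp_add]
  ring

theorem integrableOn_tailIntegrand (m : ℕ) : IntegrableOn (tailIntegrand m) (Ioi 0) := by
  refine Integrable.mono' (integrableOn_pow_mul_exp m) ?_ ?_
  · refine ContinuousOn.aestronglyMeasurable ?_ measurableSet_Ioi
    have := continuousOn_expIntegralE1
    unfold tailIntegrand
    fun_prop
  · filter_upwards [ae_restrict_mem measurableSet_Ioi] with u hu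
    have hu' : 0 < u := hu
    have h1 : 0 ≤ 1 - Real.exp (-(1 / 2 * expIntegralE1 u)) := by
      rw [sub_nonneg, Real.exp_le_one_iff]
      linarith [expIntegralE1_nonneg hu']
    unfold tailIntegrand
    rw [Real.norm_of_nonneg (by positivity)]
    have := one_sub_exp_neg_expIntegralE1_le hu'
    gcongr

/-- Integration by parts: E₁'(u) = -e^{-u}/u, so the derivative of u^m (1 - exp(-E₁(u)/2)) is the
difference of the two integrands, and this function vanishes at both ends. -/
theorem integral_tailIntegrand {m : ℕ} (hm : 1 ≤ m) :
    ∫ u in Ioi (0 : ℝ), tailIntegrand m u = 1 / 2 * ∫ u in Ioi (0 : ℝ), momentIntegrand m u := by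
  set F : ℝ → ℝ := fun u => u ^ m * (1 - Real.exp (-(1 / 2 * expIntegralE1 u))) with hF
  have hder : ∀ u ∈ Ioi (0 : ℝ), HasDerivAt F
      (tailIntegrand m u - 1 / 2 * momentIntegrand m u) u := by
    intro u hu
    have hu' : (0 : ℝ) < u := hu
    refine ((hasDerivAt_pow m u).mul
      (((hasDerivAt_expIntegralE1 hu').const_mul (1 / 2)).neg.exp.const_sub 1)).congr_deriv ?_
    unfold tailIntegrand momentIntegrand
    have e1 : -(1 / 2) * expIntegralE1 u - u = -(1 / 2 * expIntegralE1 u) + -u := by ring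
    obtain ⟨k, rfl⟩ : ∃ k, m = k + 1 := ⟨m - 1, by omega⟩
    rw [e1, Real.exp_add, Nat.add_sub_cancel, pow_succ]
    simp only [Pi.neg_apply]
    field_simp
    ring
  -- At 0 the value given to `expIntegralE1` is immaterial, since the factor u^m vanishes for m ≥ 1.
  have hbd : ∀ u, 0 ≤ u → 0 ≤ F u ∧ F u ≤ u ^ m := by
    intro u hu
    rcases hu.eq_or_lt with rfl | hu
    · have : m ≠ 0 := by omega
      simp [hF, this]
    · have h1 : 0 ≤ 1 - Real.exp (-(1 / 2 * expIntegralE1 u)) := by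
        rw [sub_nonneg, Real.exp_le_one_iff]
        linarith [expIntegralE1_nonneg hu]
      have h2 := Real.exp_pos (-(1 / 2 * expIntegralE1 u))
      refine ⟨mul_nonneg (by positivity) h1, ?_⟩
      exact mul_le_of_le_one_right (by positivity) (by linarith)
  have hF0 : F 0 = 0 := le_antisymm ((hbd 0 le_rfl).2.trans (by
    have : m ≠ 0 := by omega
    simp [this])) (hbd 0 le_rfl).1
  have hcont : ContinuousWithinAt F (Ici 0) 0 := by
    rw [ContinuousWithinAt, hF0]
    have h1 : Tendsto (fun u : ℝ => u ^ m) (𝓝[≥] 0) (𝓝 0) := by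
      have : m ≠ 0 := by omega
      have h := (continuous_pow (M := ℝ) m).tendsto 0
      rw [zero_pow this] at h
      exact h.mono_left nhdsWithin_le_nhds
    refine tendsto_of_tendsto_of_tendsto_of_le_of_le' tendsto_const_nhds h1 ?_ ?_
    · filter_upwards [self_mem_nhdsWithin] with u hu using (hbd u hu).1
    · filter_upwards [self_mem_nhdsWithin] with u hu using (hbd u hu).2
  have htop : Tendsto F atTop (𝓝 0) := by
    have h1 : Tendsto (fun u : ℝ => Real.exp 2 * (u ^ m * Real.exp (-u))) atTop (𝓝 0) := by
      simpa using (Real.tendsto_pow_mul_exp_neg_atTop_nhds_zero m).const_mul (Real.exp 2)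
    refine tendsto_of_tendsto_of_tendsto_of_le_of_le' tendsto_const_nhds h1 ?_ ?_
    · filter_upwards [eventually_ge_atTop 0] with u hu using (hbd u hu).1
    · filter_upwards [eventually_gt_atTop 0] with u hu
      have h2 := mul_le_mul_of_nonneg_left (one_sub_exp_neg_expIntegralE1_le hu)
        (pow_nonneg hu.le m)
      rw [sub_eq_add_neg 2 u, Real.exp_add] at h2
      simp only [hF]
      linarith
  have h := integral_Ioi_of_hasDerivAt_of_tendsto hcont hder
    ((integrableOn_tailIntegrand m).sub ((integrableOn_momentIntegrand m).const_mul (1 / 2))) htop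
  rw [hF0, integral_sub (integrableOn_tailIntegrand m)
    ((integrableOn_momentIntegrand m).const_mul (1 / 2)), integral_const_mul] at h
  linarith

end ExpIntegral

/-! ### Laplace asymptotics of the moments -/

section Laplace

/-- The contribution of the components of size larger than `k` to the logarithm of the generating
function, at `exp (-s)`. -/
noncomputable def tailLog (k : ℕ) (s : ℝ) : ℝ :=
  ∑' j : ℕ, (if j < k then 0 else weight j) / (j + 1) * Real.exp (-s) ^ (j + 1)

theorem abs_exp_neg_lt_one {s : ℝ} (hs : 0 < s) : |Real.exp (-s)| < 1 := by
  rw [abs_of_pos (Real.exp_pos _), Real.exp_lt_one_iff]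
  linarith

theorem summable_div_succ_mul_pow {e : ℕ → ℝ} (h0 : ∀ j, 0 ≤ e j) (h1 : ∀ j, e j ≤ 1) {x : ℝ}
    (hx0 : 0 ≤ x) (hx : x < 1) : Summable fun j : ℕ => e j / (j + 1) * x ^ (j + 1) := by
  refine Summable.of_nonneg_of_le (fun j => ?_) (fun j => ?_)
    ((summable_geometric_of_lt_one hx0 hx).mul_right x)
  · have := h0 j
    positivity
  · rw [← pow_succ]
    refine mul_le_of_le_one_left (by positivity) ?_
    rw [div_le_one (by positivity)]
    linarith [h1 j, (Nat.cast_nonneg j : (0 : ℝ) ≤ j)]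

theorem summable_tailLog (k : ℕ) {s : ℝ} (hs : 0 < s) :
    Summable fun j : ℕ => (if j < k then 0 else weight j) / ((j : ℝ) + 1) * Real.exp (-s) ^ (j + 1) := by
  refine summable_div_succ_mul_pow (e := fun j => if j < k then 0 else weight j)
    (fun j => ?_) (fun j => ?_) (Real.exp_pos _).le ((le_abs_self _).trans_lt (abs_exp_neg_lt_one hs))
  · split_ifs
    exacts [le_rfl, weight_nonneg j]
  · split_ifs
    exacts [zero_le_one, weight_le_one j]

theorem tailLog_nonneg (k : ℕ) (s : ℝ) : 0 ≤ tailLog k s :=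
  tsum_nonneg fun j => by
    have : (0 : ℝ) ≤ if j < k then 0 else weight j := by
      split_ifs
      exacts [le_rfl, weight_nonneg j]
    positivity

/-- The generating function of the normalised number of squares, at `exp (-s)`. -/
noncomputable def squareGenFun (s : ℝ) : ℝ :=
  Real.exp (∑' j : ℕ, weight j / (j + 1) * Real.exp (-s) ^ (j + 1))

theorem hasSum_expCoeff_weight {s : ℝ} (hs : 0 < s) :
    HasSum (fun n => expCoeff weight n * Real.exp (-s) ^ n) (squareGenFun s) :=
  hasSum_expCoeff weight_nonneg weight_le_one (abs_exp_neg_lt_one hs)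

theorem hasSum_expCoeff_weightUpTo (k : ℕ) {s : ℝ} (hs : 0 < s) :
    HasSum (fun n => expCoeff (weightUpTo k) n * Real.exp (-s) ^ n)
      (squareGenFun s * Real.exp (-tailLog k s)) := by
  have h := hasSum_expCoeff (weightUpTo_nonneg k) (weightUpTo_le_one k) (abs_exp_neg_lt_one hs)
  have hx : Real.exp (-s) < 1 := (le_abs_self _).trans_lt (abs_exp_neg_lt_one hs)
  have e1 : ∑' j : ℕ, weight j / (j + 1) * Real.exp (-s) ^ (j + 1) =
      ∑' j : ℕ, weightUpTo k j / (j + 1) * Real.exp (-s) ^ (j + 1) + tailLog k s := by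
    rw [tailLog, ← (summable_div_succ_mul_pow (weightUpTo_nonneg k) (weightUpTo_le_one k)
      (Real.exp_pos _).le hx).tsum_add (summable_tailLog k hs)]
    refine tsum_congr fun j => ?_
    unfold weightUpTo
    split_ifs <;> ring
  rwa [squareGenFun, e1, ← Real.exp_add, add_neg_cancel_right]

/-- All weights are 1/2 except for an extra 1/2 at index 0; summing the logarithmic series gives
Q(x) = e^{x/2} (1-x)^{-1/2}, and 1 - e^{-s} ~ s. -/
theorem tendsto_squareGenFun :
    Tendsto (fun s : ℝ => s ^ (1 / 2 : ℝ) * squareGenFun s) (𝓝[>] 0) (𝓝 (Real.exp (1 / 2))) := by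
  have hf : ∀ s : ℝ, 0 < s → s ^ (1 / 2 : ℝ) * squareGenFun s =
      Real.exp (1 / 2 * Real.exp (-s)) * (((1 - Real.exp (-s)) / s)⁻¹) ^ (1 / 2 : ℝ) := by
    intro s hs
    have hx := abs_exp_neg_lt_one hs
    have hx1 : Real.exp (-s) < 1 := (le_abs_self _).trans_lt hx
    have h1 := (Real.hasSum_pow_div_log_of_abs_lt_one hx).mul_left (1 / 2)
    have h2 : HasSum (fun j : ℕ => if j = 0 then 1 / 2 * Real.exp (-s) else 0)
        (1 / 2 * Real.exp (-s)) := hasSum_ite_eq 0 _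
    have h3 : HasSum (fun j : ℕ => weight j / (j + 1) * Real.exp (-s) ^ (j + 1))
        (1 / 2 * Real.exp (-s) + 1 / 2 * -Real.log (1 - Real.exp (-s))) := by
      refine (h2.add h1).congr_fun fun j => ?_
      unfold weight
      split_ifs with h
      · subst h; simp; ring
      · ring
    have hp : 0 < 1 - Real.exp (-s) := by linarith
    rw [squareGenFun, h3.tsum_eq, Real.exp_add, Real.rpow_def_of_pos hs,
      Real.rpow_def_of_pos (by positivity), mul_left_comm, ← Real.exp_add, inv_div,
      Real.log_div hs.ne' hp.ne']
    congr 2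
    ring
  have hlim : Tendsto (fun s : ℝ => (1 - Real.exp (-s)) / s) (𝓝[>] 0) (𝓝 1) := by
    have hd : HasDerivAt (fun s : ℝ => 1 - Real.exp (-s)) 1 0 := by
      refine ((hasDerivAt_id (0 : ℝ)).neg.exp.const_sub 1).congr_deriv ?_
      simp
    have h := hd.tendsto_slope_zero_right
    refine h.congr' ?_
    filter_upwards with s
    simp
    ring
  have h4 : Tendsto (fun s : ℝ => Real.exp (1 / 2 * Real.exp (-s)) *
      (((1 - Real.exp (-s)) / s)⁻¹) ^ (1 / 2 : ℝ)) (𝓝[>] 0)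
        (𝓝 (Real.exp (1 / 2 * Real.exp (-0)) * ((1 : ℝ)⁻¹) ^ (1 / 2 : ℝ))) := by
    refine Tendsto.mul ?_ ?_
    · have : Continuous fun s : ℝ => Real.exp (1 / 2 * Real.exp (-s)) := by fun_prop
      exact (this.tendsto 0).mono_left nhdsWithin_le_nhds
    · exact (hlim.inv₀ one_ne_zero).rpow_const (Or.inr (by norm_num))
  simp only [neg_zero, Real.exp_zero, mul_one, inv_one, Real.one_rpow] at h4
  refine h4.congr' ?_
  filter_upwards [self_mem_nhdsWithin] with s hs using (hf s hs).symm

theorem tailLog_eq {k : ℕ} (hk : 1 ≤ k) {s : ℝ} (hs : 0 < s) :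
    HasSum (fun i : ℕ => 1 / 2 * (Real.exp (-(s * (k + i + 1))) / (k + i + 1))) (tailLog k s) := by
  have h := (summable_tailLog k hs).hasSum
  rw [← hasSum_nat_add_iff' k] at h
  rw [Finset.sum_eq_zero, sub_zero] at h
  · refine h.congr_fun fun i => ?_
    have h1 : ¬ (i + k < k) := by omega
    have h2 : i + k ≠ 0 := by omega
    rw [if_neg h1, weight, if_neg h2, ← Real.exp_nat_mul]
    have e1 : ((i + k + 1 : ℕ) : ℝ) * -s = -(s * (k + i + 1)) := by push_cast; ring
    rw [e1]
    push_cast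
    rw [add_comm (i : ℝ)]
    ring
  · intro j hj
    rw [if_pos (Finset.mem_range.mp hj)]
    simp

/-- The term e^{-sj}/j is the area of a rectangle of width s and height e^{-v}/v at v = sj. As the
height decreases in v, it is below the integral over the interval to its left, and these integrals
telescope. In `le_tailLog` the interval to the right gives the opposite bound. -/
theorem tailLog_le {k : ℕ} (hk : 1 ≤ k) {s : ℝ} (hs : 0 < s) :
    tailLog k s ≤ 1 / 2 * expIntegralE1 (s * k) := by
  have hk0 : (0 : ℝ) < k := by exact_mod_cast hk
  refine le_of_tendsto' (tailLog_eq hk hs).tendsto_sum_nat fun N => ?_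
  have hterm : ∀ i ∈ Finset.range N, 1 / 2 * (Real.exp (-(s * (k + i + 1))) / (k + i + 1)) ≤
      1 / 2 * (expIntegralE1 (s * (k + i)) - expIntegralE1 (s * (k + (i + 1 : ℕ)))) := by
    intro i _
    have hi : (0 : ℝ) ≤ i := Nat.cast_nonneg i
    have h := le_expIntegralE1_sub (a := s * (k + i)) (b := s * (k + (i + 1 : ℕ))) (by positivity)
      (by push_cast; nlinarith)
    have e : (s * (k + (i + 1 : ℕ)) - s * (k + i)) * (Real.exp (-(s * (k + (i + 1 : ℕ)))) /
        (s * (k + (i + 1 : ℕ)))) = Real.exp (-(s * (k + i + 1))) / (k + i + 1) := by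
      push_cast
      rw [← add_assoc]
      field_simp
      ring
    rw [e] at h
    linarith
  refine (Finset.sum_le_sum hterm).trans ?_
  rw [← Finset.mul_sum, Finset.sum_range_sub' (fun i : ℕ => expIntegralE1 (s * (k + i)))]
  have : 0 ≤ expIntegralE1 (s * (k + N)) := expIntegralE1_nonneg (by positivity)
  simp only [Nat.cast_zero, add_zero]
  linarith

theorem le_tailLog {k : ℕ} (hk : 1 ≤ k) {s : ℝ} (hs : 0 < s) :
    1 / 2 * expIntegralE1 (s * (k + 1)) ≤ tailLog k s := by
  have hk0 : (0 : ℝ) < k := by exact_mod_cast hk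
  have hsum := tailLog_eq hk hs
  have hN : ∀ N : ℕ, 1 / 2 * (expIntegralE1 (s * (k + 1)) - expIntegralE1 (s * (k + 1 + N))) ≤
      tailLog k s := by
    intro N
    refine le_trans ?_ (sum_le_hasSum (Finset.range N) (fun i _ => by positivity) hsum)
    have hterm : ∀ i ∈ Finset.range N,
        1 / 2 * (expIntegralE1 (s * (k + 1 + i)) - expIntegralE1 (s * (k + 1 + (i + 1 : ℕ)))) ≤
          1 / 2 * (Real.exp (-(s * (k + i + 1))) / (k + i + 1)) := by
      intro i _
      have hi : (0 : ℝ) ≤ i := Nat.cast_nonneg i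
      have h := expIntegralE1_sub_le (a := s * (k + 1 + i)) (b := s * (k + 1 + (i + 1 : ℕ)))
        (by positivity) (by push_cast; nlinarith)
      have e : (s * (k + 1 + (i + 1 : ℕ)) - s * (k + 1 + i)) * (Real.exp (-(s * (k + 1 + i))) /
          (s * (k + 1 + i))) = Real.exp (-(s * (k + i + 1))) / (k + i + 1) := by
        push_cast
        rw [add_right_comm (k : ℝ) 1 i]
        field_simp
        ring
      rw [e] at h
      linarith
    refine le_trans ?_ (Finset.sum_le_sum hterm)
    rw [← Finset.mul_sum, Finset.sum_range_sub' (fun i : ℕ => expIntegralE1 (s * (k + 1 + i)))]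
    simp
  have hlim : Tendsto (fun N : ℕ => 1 / 2 * (expIntegralE1 (s * (k + 1)) -
      expIntegralE1 (s * (k + 1 + N)))) atTop (𝓝 (1 / 2 * (expIntegralE1 (s * (k + 1)) - 0))) := by
    refine (tendsto_const_nhds.sub (tendsto_expIntegralE1_atTop.comp ?_)).const_mul _
    exact Tendsto.const_mul_atTop hs (tendsto_atTop_add_const_left _ _ tendsto_natCast_atTop_atTop)
  rw [sub_zero] at hlim
  exact le_of_tendsto' hlim hN

/-- The `m`-th moment of the largest component of a uniform square of dimension `n`, by summation
by parts. -/
noncomputable def momentSeq (m n : ℕ) : ℝ :=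
  ∑ k ∈ Finset.range n, (((k : ℝ) + 1) ^ m - (k : ℝ) ^ m) *
    (1 - expCoeff (weightUpTo k) n / expCoeff weight n)

theorem pow_succ_sub_pow_nonneg (m k : ℕ) : (0 : ℝ) ≤ ((k : ℝ) + 1) ^ m - (k : ℝ) ^ m := by
  rw [sub_nonneg]
  gcongr
  linarith

theorem one_sub_ratio_nonneg (k n : ℕ) :
    0 ≤ 1 - expCoeff (weightUpTo k) n / expCoeff weight n := by
  rw [sub_nonneg, div_le_one (expCoeff_weight_pos n)]
  exact expCoeff_weightUpTo_le k n

theorem momentSeq_nonneg (m n : ℕ) : 0 ≤ momentSeq m n :=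
  Finset.sum_nonneg fun k _ => mul_nonneg (pow_succ_sub_pow_nonneg m k) (one_sub_ratio_nonneg k n)

/-- The Tauberian condition: with growing n every existing summand grows, as q_k(n)/q(n) decreases,
and the new summand is non-negative. -/
theorem momentSeq_monotone (m : ℕ) : Monotone (momentSeq m) := by
  refine monotone_nat_of_le_succ fun n => ?_
  unfold momentSeq
  refine (Finset.sum_le_sum fun k _ => ?_).trans (Finset.sum_le_sum_of_subset_of_nonneg
    (Finset.range_subset_range.mpr n.le_succ) fun k _ _ =>
      mul_nonneg (pow_succ_sub_pow_nonneg m k) (one_sub_ratio_nonneg k (n + 1)))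
  exact mul_le_mul_of_nonneg_left (by linarith [expCoeff_ratio_succ_le k n])
    (pow_succ_sub_pow_nonneg m k)

theorem momentSeq_le {m : ℕ} (hm : 1 ≤ m) (n : ℕ) : momentSeq m n ≤ (n : ℝ) ^ m := by
  have h := Finset.sum_range_sub (fun k : ℕ => (k : ℝ) ^ m) n
  have : m ≠ 0 := by omega
  simp only [Nat.cast_zero, zero_pow this, sub_zero, Nat.cast_succ] at h
  rw [← h]
  refine Finset.sum_le_sum fun k _ => mul_le_of_le_one_right (pow_succ_sub_pow_nonneg m k) ?_
  have := div_nonneg (expCoeff_nonneg (weightUpTo_nonneg k) n) (expCoeff_weight_pos n).le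
  linarith

/-- Exchange of two non-negative sums. Summands with k ≥ n vanish because q_k(n) = q(n) there, so k
may range over all naturals; for fixed k the sum over n is a difference of two generating functions.
-/
theorem tsum_momentSeq {m : ℕ} (hm : 1 ≤ m) {s : ℝ} (hs : 0 < s) :
    ∑' n, expCoeff weight n * momentSeq m n * Real.exp (-s) ^ n =
      squareGenFun s * ∑' k : ℕ, (((k : ℝ) + 1) ^ m - (k : ℝ) ^ m) *
        (1 - Real.exp (-tailLog k s)) := by
  set x := Real.exp (-s) with hx
  have hx0 : 0 < x := Real.exp_pos _
  set t : ℕ → ℕ → ℝ := fun n k => (((k : ℝ) + 1) ^ m - (k : ℝ) ^ m) *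
    (expCoeff weight n - expCoeff (weightUpTo k) n) * x ^ n with ht
  have ht0 : ∀ n k, 0 ≤ t n k := fun n k =>
    mul_nonneg (mul_nonneg (pow_succ_sub_pow_nonneg m k)
      (sub_nonneg.mpr (expCoeff_weightUpTo_le k n))) (by positivity)
  have hrow : ∀ n, HasSum (t n) (expCoeff weight n * momentSeq m n * x ^ n) := fun n => by
    have h : expCoeff weight n * momentSeq m n * x ^ n = ∑ k ∈ Finset.range n, t n k := by
      rw [momentSeq, Finset.mul_sum, Finset.sum_mul]
      refine Finset.sum_congr rfl fun k _ => ?_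
      have := (expCoeff_weight_pos n).ne'
      simp only [ht]
      field_simp
    rw [h]
    refine hasSum_sum_of_ne_finset_zero fun k hk => ?_
    simp only [ht]
    rw [expCoeff_weightUpTo_of_le (by simpa using hk), sub_self, mul_zero, zero_mul]
  have hsummable : Summable (Function.uncurry t) := by
    refine (summable_prod_of_nonneg (f := Function.uncurry t) fun p => ht0 p.1 p.2).mpr ⟨fun n => (hrow n).summable, ?_⟩
    simp only [Function.uncurry_apply_pair, (hrow _).tsum_eq]
    have hg := summable_pow_mul_geometric_of_norm_lt_one m (r := x) (abs_exp_neg_lt_one hs)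
    refine Summable.of_nonneg_of_le (fun n => ?_) (fun n => ?_) hg
    · exact mul_nonneg (mul_nonneg (expCoeff_weight_pos n).le (momentSeq_nonneg m n)) (by positivity)
    · refine mul_le_mul_of_nonneg_right ?_ (by positivity)
      exact (mul_le_of_le_one_left (momentSeq_nonneg m n)
        (expCoeff_le_one weight_nonneg weight_le_one n)).trans (momentSeq_le hm n)
  have hcol : ∀ k, HasSum (fun n => t n k) ((((k : ℝ) + 1) ^ m - (k : ℝ) ^ m) *
      (squareGenFun s - squareGenFun s * Real.exp (-tailLog k s))) := fun k => by
    refine (((hasSum_expCoeff_weight hs).sub (hasSum_expCoeff_weightUpTo k hs)).mul_left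
      (((k : ℝ) + 1) ^ m - (k : ℝ) ^ m)).congr_fun fun n => ?_
    simp only [ht]
    ring
  calc ∑' n, expCoeff weight n * momentSeq m n * x ^ n = ∑' n, ∑' k, t n k :=
        tsum_congr fun n => (hrow n).tsum_eq.symm
    _ = ∑' k, ∑' n, t n k := (Summable.tsum_comm hsummable).symm
    _ = ∑' k : ℕ, squareGenFun s * ((((k : ℝ) + 1) ^ m - (k : ℝ) ^ m) *
          (1 - Real.exp (-tailLog k s))) := tsum_congr fun k => by
        rw [(hcol k).tsum_eq]
        ring
    _ = _ := tsum_mul_left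

/-- The Riemann sum is exactly the integral of a step function, since m u^{m-1} integrates to s^m
((k+1)^m - k^m) over [sk, s(k+1)). Its limit can then be taken by dominated convergence. -/
theorem hasSum_pow_sub_pow_mul {m : ℕ} (hm : 1 ≤ m) {s : ℝ} (hs : 0 < s) (h : ℕ → ℝ)
    (hint : IntegrableOn (fun u : ℝ => m * u ^ (m - 1) * h ⌊u / s⌋₊) (Ici 0)) :
    HasSum (fun k : ℕ => s ^ m * ((((k : ℝ) + 1) ^ m - (k : ℝ) ^ m) * h k))
      (∫ u in Ici (0 : ℝ), m * u ^ (m - 1) * h ⌊u / s⌋₊) := by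
  have hfloor : ∀ (k : ℕ) (u : ℝ), u ∈ Ico (s * k) (s * (k + 1)) → ⌊u / s⌋₊ = k := fun k u hu => by
    rw [Nat.floor_eq_iff (div_nonneg ((by positivity : 0 ≤ s * (k : ℝ)).trans hu.1) hs.le),
      le_div_iff₀ hs, div_lt_iff₀ hs]
    exact ⟨by linarith [hu.1], by linarith [hu.2]⟩
  have hU : (⋃ k : ℕ, Ico (s * (k : ℝ)) (s * (k + 1))) = Ici 0 := by
    ext u
    simp only [mem_iUnion, mem_Ici]
    constructor
    · rintro ⟨k, hk⟩
      exact (by positivity : 0 ≤ s * (k : ℝ)).trans hk.1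
    · intro hu
      have h1 := Nat.floor_le (div_nonneg hu hs.le)
      have h2 := Nat.lt_floor_add_one (u / s)
      rw [le_div_iff₀ hs] at h1
      rw [div_lt_iff₀ hs] at h2
      exact ⟨⌊u / s⌋₊, by linarith, by linarith⟩
  have hdisj : Pairwise (Function.onFun Disjoint fun k : ℕ => Ico (s * (k : ℝ)) (s * (k + 1))) := by
    intro k l hkl
    rw [Function.onFun, Set.disjoint_left]
    intro u hu hu'
    exact hkl ((hfloor k u hu).symm.trans (hfloor l u hu'))
  rw [← hU] at hint ⊢
  refine (hasSum_integral_iUnion (fun k => measurableSet_Ico) hdisj hint).congr_fun fun k => ?_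
  have hle : s * (k : ℝ) ≤ s * (k + 1) := by nlinarith
  rw [setIntegral_congr_fun (g := fun u : ℝ => m * u ^ (m - 1) * h k) measurableSet_Ico
    (fun u hu => by simp only [hfloor k u hu]), integral_Ico_eq_integral_Ioc,
    ← intervalIntegral.integral_of_le hle, intervalIntegral.integral_mul_const,
    intervalIntegral.integral_const_mul, integral_pow]
  have e : m - 1 + 1 = m := by omega
  have e' : ((m - 1 : ℕ) : ℝ) + 1 = m := by exact_mod_cast e
  have : (m : ℝ) ≠ 0 := by
    have : m ≠ 0 := by omega
    exact_mod_cast this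
  rw [e', e, mul_pow, mul_pow]
  field_simp

theorem tendsto_floor_div_mul {u : ℝ} (hu : 0 < u) :
    Tendsto (fun s : ℝ => s * (⌊u / s⌋₊ : ℝ)) (𝓝[>] 0) (𝓝 u) := by
  have h1 : Tendsto (fun s : ℝ => u - s) (𝓝[>] 0) (𝓝 u) := by
    have : Continuous fun s : ℝ => u - s := by fun_prop
    simpa using (this.tendsto 0).mono_left (nhdsWithin_le_nhds (s := Ioi 0))
  refine tendsto_of_tendsto_of_tendsto_of_le_of_le' h1 tendsto_const_nhds ?_ ?_
  · filter_upwards [self_mem_nhdsWithin] with s hs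
    have hs' : (0 : ℝ) < s := hs
    have h2 := Nat.lt_floor_add_one (u / s)
    rw [div_lt_iff₀ hs'] at h2
    linarith
  · filter_upwards [self_mem_nhdsWithin] with s hs
    have hs' : (0 : ℝ) < s := hs
    have h2 := Nat.floor_le (div_nonneg hu.le hs'.le)
    rw [le_div_iff₀ hs'] at h2
    linarith

theorem tendsto_tailLog_floor {u : ℝ} (hu : 0 < u) :
    Tendsto (fun s : ℝ => tailLog ⌊u / s⌋₊ s) (𝓝[>] 0) (𝓝 (1 / 2 * expIntegralE1 u)) := by
  have hc : ContinuousAt expIntegralE1 u := (hasDerivAt_expIntegralE1 hu).continuousAt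
  have h1 := tendsto_floor_div_mul hu
  have h2 : Tendsto (fun s : ℝ => s * ((⌊u / s⌋₊ : ℝ) + 1)) (𝓝[>] 0) (𝓝 u) := by
    have h3 : Tendsto (fun s : ℝ => s) (𝓝[>] 0) (𝓝 0) := nhdsWithin_le_nhds
    simpa [mul_add] using h1.add h3
  have hk : ∀ᶠ s in 𝓝[>] (0 : ℝ), 0 < s ∧ 1 ≤ ⌊u / s⌋₊ := by
    filter_upwards [Ioo_mem_nhdsGT hu] with s hs
    refine ⟨hs.1, Nat.one_le_floor_iff _ |>.mpr ?_⟩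
    rw [one_le_div hs.1]
    exact hs.2.le
  refine tendsto_of_tendsto_of_tendsto_of_le_of_le' ((hc.tendsto.comp h2).const_mul (1 / 2))
    ((hc.tendsto.comp h1).const_mul (1 / 2)) ?_ ?_
  · filter_upwards [hk] with s hs using le_tailLog hs.2 hs.1
  · filter_upwards [hk] with s hs using tailLog_le hs.2 hs.1

/-- The floor moves u by at most s ≤ 1, so for u ≥ 2 the point s⌊u/s⌋ is at least u - 1 ≥ 1, where
E₁(v) ≤ e^{-v}. For u ≤ 2 the right side exceeds 1. -/
theorem one_sub_exp_neg_tailLog_floor_le {s u : ℝ} (hs : 0 < s) (hs1 : s ≤ 1) :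
    1 - Real.exp (-tailLog ⌊u / s⌋₊ s) ≤ Real.exp (2 - u) := by
  rcases le_total u 2 with h | h
  · have h1 : 1 ≤ Real.exp (2 - u) := Real.one_le_exp (by linarith)
    have h2 := Real.exp_pos (-tailLog ⌊u / s⌋₊ s)
    linarith
  · have h2 := Nat.lt_floor_add_one (u / s)
    rw [div_lt_iff₀ hs] at h2
    set k := ⌊u / s⌋₊ with hkdef
    have hk : 1 ≤ k := by
      rw [hkdef, Nat.one_le_floor_iff, one_le_div hs]
      linarith
    have h3 : u - 1 ≤ s * k := by nlinarith
    have h4 := tailLog_le hk hs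
    have h5 := expIntegralE1_le (show 0 < s * (k : ℝ) by linarith)
    have h6 : Real.exp (-(s * k)) / (s * k) ≤ Real.exp (-(s * k)) :=
      div_le_self (Real.exp_pos _).le (by linarith)
    have h7 : Real.exp (-(s * k)) ≤ Real.exp (2 - u) := Real.exp_le_exp.mpr (by linarith)
    have h8 := Real.add_one_le_exp (-tailLog k s)
    have h9 := Real.exp_pos (-(s * k))
    linarith

theorem tendsto_laplace_momentSeq {m : ℕ} (hm : 1 ≤ m) :
    Tendsto (fun s : ℝ => s ^ (1 / 2 + m : ℝ) *
      ∑' n, expCoeff weight n * momentSeq m n * Real.exp (-s) ^ n) (𝓝[>] 0)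
        (𝓝 (Real.exp (1 / 2) * (1 / 2 * ∫ u in Ioi (0 : ℝ), momentIntegrand m u))) := by
  set G : ℝ → ℝ → ℝ := fun s u => m * u ^ (m - 1) * (1 - Real.exp (-tailLog ⌊u / s⌋₊ s)) with hG
  have hmeas : ∀ s, AEStronglyMeasurable (G s) (volume.restrict (Ici 0)) := fun s => by
    have h1 : Measurable fun u : ℝ => 1 - Real.exp (-tailLog ⌊u / s⌋₊ s) :=
      (measurable_from_nat (f := fun k : ℕ => 1 - Real.exp (-tailLog k s))).comp
        (Nat.measurable_floor.comp (measurable_id.div_const s))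
    exact (Measurable.mul (by fun_prop) h1).aestronglyMeasurable
  have hbd : ∀ s u : ℝ, 0 < s → s ≤ 1 → 0 ≤ u → ‖G s u‖ ≤ m * u ^ (m - 1) * Real.exp (2 - u) := by
    intro s u hs hs1 hu
    have h1 : 0 ≤ 1 - Real.exp (-tailLog ⌊u / s⌋₊ s) := by
      rw [sub_nonneg, Real.exp_le_one_iff, neg_nonpos]
      exact tailLog_nonneg _ _
    simp only [hG]
    rw [Real.norm_of_nonneg (by positivity)]
    have := one_sub_exp_neg_tailLog_floor_le (u := u) hs hs1
    gcongr
  have hbint : IntegrableOn (fun u : ℝ => m * u ^ (m - 1) * Real.exp (2 - u)) (Ici 0) := by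
    rw [integrableOn_Ici_iff_integrableOn_Ioi]
    exact integrableOn_pow_mul_exp m
  have hev : ∀ᶠ s in 𝓝[>] (0 : ℝ), 0 < s ∧ s ≤ 1 := by
    filter_upwards [Ioo_mem_nhdsGT one_pos] with s hs using ⟨hs.1, hs.2.le⟩
  have hint : Tendsto (fun s => ∫ u in Ici (0 : ℝ), G s u) (𝓝[>] 0)
      (𝓝 (∫ u in Ici (0 : ℝ), tailIntegrand m u)) := by
    refine tendsto_integral_filter_of_dominated_convergence
      (fun u : ℝ => m * u ^ (m - 1) * Real.exp (2 - u)) (Eventually.of_forall hmeas) ?_ hbint ?_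
    · filter_upwards [hev] with s hs
      filter_upwards [ae_restrict_mem measurableSet_Ici] with u hu using hbd s u hs.1 hs.2 hu
    · rw [← restrict_Ioi_eq_restrict_Ici]
      filter_upwards [ae_restrict_mem measurableSet_Ioi] with u hu
      unfold tailIntegrand
      refine Tendsto.const_mul _ (tendsto_const_nhds.sub ?_)
      exact (Real.continuous_exp.tendsto _).comp (tendsto_tailLog_floor hu).neg
  rw [integral_Ici_eq_integral_Ioi, integral_tailIntegrand hm] at hint
  refine (tendsto_squareGenFun.mul hint).congr' ?_
  filter_upwards [hev] with s hs
  have hsum := hasSum_pow_sub_pow_mul hm hs.1 (fun k => 1 - Real.exp (-tailLog k s))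
    (Integrable.mono' hbint (hmeas s) (by
      filter_upwards [ae_restrict_mem measurableSet_Ici] with u hu using hbd s u hs.1 hs.2 hu))
  rw [tsum_momentSeq hm hs.1, ← hsum.tsum_eq, tsum_mul_left, Real.rpow_add hs.1, Real.rpow_natCast]
  ring

end Laplace

/-! ### Karamata's method and a Tauberian theorem for monotone sequences -/

section Karamata

theorem tendsto_of_forall_approx {ι : Type*} {l : Filter ι} {f : ι → ℝ} {a : ℝ}
    (h : ∀ ε > 0, ∃ (g : ι → ℝ) (b : ℝ), Tendsto g l (𝓝 b) ∧ (∀ᶠ i in l, |f i - g i| ≤ ε) ∧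
      |a - b| ≤ ε) : Tendsto f l (𝓝 a) := by
  rw [Metric.tendsto_nhds]
  intro ε hε
  obtain ⟨g, b, hg, hfg, hab⟩ := h (ε / 4) (by positivity)
  filter_upwards [Metric.tendsto_nhds.mp hg (ε / 4) (by positivity), hfg] with i h1 h2
  rw [Real.dist_eq] at h1 ⊢
  rw [abs_lt] at h1 ⊢
  rw [abs_le] at h2 hab
  constructor <;> linarith [h1.1, h1.2, h2.1, h2.2, hab.1, hab.2]

/-- `s ^ α * ∑ b n * φ (e ^ (-s n)) * e ^ (-s n)`. -/
noncomputable def laplaceSum (b : ℕ → ℝ) (α : ℝ) (φ : ℝ → ℝ) (s : ℝ) : ℝ :=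
  s ^ α * ∑' n, b n * (φ (Real.exp (-s) ^ n) * Real.exp (-s) ^ n)

/-- `∫ u ^ (α - 1) * e ^ (-u) * φ (e ^ (-u))` over `u > 0`. -/
noncomputable def gammaIntegral (α : ℝ) (φ : ℝ → ℝ) : ℝ :=
  ∫ u in Ioi (0 : ℝ), Real.exp (-u) * u ^ (α - 1) * φ (Real.exp (-u))

theorem exp_neg_pow_mem_Icc {s : ℝ} (hs : 0 < s) (n : ℕ) : Real.exp (-s) ^ n ∈ Icc (0 : ℝ) 1 :=
  ⟨by positivity, pow_le_one₀ (Real.exp_pos _).le (Real.exp_le_one_iff.mpr (by linarith))⟩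

theorem exp_neg_mem_Icc {u : ℝ} (hu : 0 < u) : Real.exp (-u) ∈ Icc (0 : ℝ) 1 :=
  ⟨(Real.exp_pos _).le, Real.exp_le_one_iff.mpr (by linarith)⟩

theorem exists_bound_Icc {φ : ℝ → ℝ} (hφ : Continuous φ) : ∃ M, ∀ x ∈ Icc (0 : ℝ) 1, |φ x| ≤ M :=
  isCompact_Icc.exists_bound_of_continuousOn hφ.continuousOn

theorem integrableOn_gammaIntegral {α : ℝ} (hα : 0 < α) {φ : ℝ → ℝ} (hφ : Continuous φ) :
    IntegrableOn (fun u : ℝ => Real.exp (-u) * u ^ (α - 1) * φ (Real.exp (-u))) (Ioi 0) := by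
  obtain ⟨M, hM⟩ := exists_bound_Icc hφ
  refine Integrable.mul_bdd (c := M) (Real.GammaIntegral_convergent hα)
    (Continuous.aestronglyMeasurable (by fun_prop)) ?_
  filter_upwards [ae_restrict_mem measurableSet_Ioi] with u hu using hM _ (exp_neg_mem_Icc hu)

variable {b : ℕ → ℝ} {α K : ℝ}

theorem summable_laplaceSum (hb : ∀ n, 0 ≤ b n)
    (hsum : ∀ s > 0, Summable fun n => b n * Real.exp (-s) ^ n) {φ : ℝ → ℝ} (hφ : Continuous φ)
    {s : ℝ} (hs : 0 < s) :
    Summable fun n => b n * (φ (Real.exp (-s) ^ n) * Real.exp (-s) ^ n) := by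
  obtain ⟨M, hM⟩ := exists_bound_Icc hφ
  refine ((hsum s hs).mul_left M).of_norm_bounded fun n => ?_
  have h1 := hb n
  have h2 : 0 < Real.exp (-s) ^ n := by positivity
  rw [norm_mul, norm_mul, Real.norm_of_nonneg h1, Real.norm_of_nonneg h2.le, Real.norm_eq_abs]
  have := mul_le_mul_of_nonneg_right (hM _ (exp_neg_pow_mem_Icc hs n)) (mul_nonneg h1 h2.le)
  linarith

theorem laplaceSum_add (hb : ∀ n, 0 ≤ b n)
    (hsum : ∀ s > 0, Summable fun n => b n * Real.exp (-s) ^ n) {φ ψ : ℝ → ℝ} (hφ : Continuous φ)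
    (hψ : Continuous ψ) {s : ℝ} (hs : 0 < s) :
    laplaceSum b α (fun x => φ x + ψ x) s = laplaceSum b α φ s + laplaceSum b α ψ s := by
  rw [laplaceSum, laplaceSum, laplaceSum, ← mul_add, ← (summable_laplaceSum hb hsum hφ hs).tsum_add
    (summable_laplaceSum hb hsum hψ hs)]
  congr 1
  exact tsum_congr fun n => by ring

theorem gammaIntegral_add (hα : 0 < α) {φ ψ : ℝ → ℝ} (hφ : Continuous φ) (hψ : Continuous ψ) :
    gammaIntegral α (fun x => φ x + ψ x) = gammaIntegral α φ + gammaIntegral α ψ := by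
  rw [gammaIntegral, gammaIntegral, gammaIntegral, ← integral_add (integrableOn_gammaIntegral hα hφ)
    (integrableOn_gammaIntegral hα hψ)]
  exact integral_congr_ae (Eventually.of_forall fun u => by simp only; ring)

theorem laplaceSum_mono (hb : ∀ n, 0 ≤ b n)
    (hsum : ∀ s > 0, Summable fun n => b n * Real.exp (-s) ^ n) {φ ψ : ℝ → ℝ} (hφ : Continuous φ)
    (hψ : Continuous ψ) (h : ∀ x ∈ Icc (0 : ℝ) 1, φ x ≤ ψ x) {s : ℝ} (hs : 0 < s) :
    laplaceSum b α φ s ≤ laplaceSum b α ψ s := by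
  refine mul_le_mul_of_nonneg_left ((summable_laplaceSum hb hsum hφ hs).tsum_le_tsum (fun n => ?_)
    (summable_laplaceSum hb hsum hψ hs)) (by positivity)
  exact mul_le_mul_of_nonneg_left (mul_le_mul_of_nonneg_right (h _ (exp_neg_pow_mem_Icc hs n))
    (by positivity)) (hb n)

theorem gammaIntegral_mono (hα : 0 < α) {φ ψ : ℝ → ℝ} (hφ : Continuous φ) (hψ : Continuous ψ)
    (h : ∀ x ∈ Icc (0 : ℝ) 1, φ x ≤ ψ x) : gammaIntegral α φ ≤ gammaIntegral α ψ := by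
  refine setIntegral_mono_on (integrableOn_gammaIntegral hα hφ) (integrableOn_gammaIntegral hα hψ)
    measurableSet_Ioi fun u hu => ?_
  have hu' : (0 : ℝ) < u := hu
  exact mul_le_mul_of_nonneg_left (h _ (exp_neg_mem_Icc hu)) (by positivity)

theorem gammaIntegral_const_mul_pow (hα : 0 < α) (a : ℝ) (p : ℕ) :
    gammaIntegral α (fun x => a * x ^ p) = a * ((1 / (p + 1 : ℝ)) ^ α * Real.Gamma α) := by
  rw [← Real.integral_rpow_mul_exp_neg_mul_Ioi hα (by positivity), ← integral_const_mul]
  refine integral_congr_ae (Eventually.of_forall fun u => ?_)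
  simp only
  rw [← Real.exp_nat_mul, show -(((p : ℝ) + 1) * u) = -u + p * -u by ring, Real.exp_add]
  ring

/-- Testing against x^p replaces s by (p+1)s in the Laplace transform, so the hypothesis already
covers every monomial. -/
theorem tendsto_laplaceSum_const_mul_pow
    (hlim : Tendsto (fun s : ℝ => s ^ α * ∑' n, b n * Real.exp (-s) ^ n) (𝓝[>] 0) (𝓝 K))
    (a : ℝ) (p : ℕ) :
    Tendsto (laplaceSum b α fun x => a * x ^ p) (𝓝[>] 0) (𝓝 (K * (a * (1 / (p + 1 : ℝ)) ^ α))) := by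
  have hp : (0 : ℝ) < p + 1 := by positivity
  have hscale : Tendsto (fun s : ℝ => ((p : ℝ) + 1) * s) (𝓝[>] 0) (𝓝[>] 0) := by
    refine tendsto_nhdsWithin_iff.mpr ⟨?_, ?_⟩
    · have : Continuous fun s : ℝ => ((p : ℝ) + 1) * s := by fun_prop
      simpa using (this.tendsto 0).mono_left (nhdsWithin_le_nhds (s := Ioi 0))
    · filter_upwards [self_mem_nhdsWithin] with s hs
      exact mul_pos hp hs
  have h := (hlim.comp hscale).mul_const (a * (1 / (p + 1 : ℝ)) ^ α)
  refine h.congr' ?_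
  filter_upwards [self_mem_nhdsWithin] with s hs
  have hs' : (0 : ℝ) < s := hs
  simp only [Function.comp_apply, laplaceSum]
  have e1 : ∀ n, b n * (a * (Real.exp (-s) ^ n) ^ p * Real.exp (-s) ^ n) =
      a * (b n * Real.exp (-((p + 1) * s)) ^ n) := fun n => by
    rw [← Real.exp_nat_mul, ← Real.exp_nat_mul, ← Real.exp_nat_mul, mul_assoc a, ← Real.exp_add,
      show (p : ℝ) * (n * -s) + n * -s = n * -((p + 1) * s) by ring]
    ring
  simp only [e1]
  rw [tsum_mul_left, Real.mul_rpow hp.le hs'.le, one_div, Real.inv_rpow hp.le]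
  have := (Real.rpow_pos_of_pos hp α).ne'
  field_simp

/-- Karamata's theorem on the weak convergence of the rescaled measures. -/
theorem tendsto_laplaceSum (hα : 0 < α) (hb : ∀ n, 0 ≤ b n)
    (hsum : ∀ s > 0, Summable fun n => b n * Real.exp (-s) ^ n)
    (hlim : Tendsto (fun s : ℝ => s ^ α * ∑' n, b n * Real.exp (-s) ^ n) (𝓝[>] 0) (𝓝 K))
    {φ : ℝ → ℝ} (hφ : Continuous φ) :
    Tendsto (laplaceSum b α φ) (𝓝[>] 0) (𝓝 (K / Real.Gamma α * gammaIntegral α φ)) := by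
  have hΓ := (Real.Gamma_pos_of_pos hα).ne'
  have hmono : ∀ (a : ℝ) (p : ℕ), Tendsto (laplaceSum b α fun x => a * x ^ p) (𝓝[>] 0)
      (𝓝 (K / Real.Gamma α * gammaIntegral α fun x => a * x ^ p)) := fun a p => by
    rw [gammaIntegral_const_mul_pow hα]
    convert tendsto_laplaceSum_const_mul_pow hlim a p using 2
    field_simp
  have hpoly : ∀ P : Polynomial ℝ, Tendsto (laplaceSum b α fun x => P.eval x) (𝓝[>] 0)
      (𝓝 (K / Real.Gamma α * gammaIntegral α fun x => P.eval x)) := by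
    intro P
    induction P using Polynomial.induction_on' with
    | add P Q hP hQ =>
      simp only [Polynomial.eval_add]
      rw [gammaIntegral_add hα P.continuous Q.continuous, mul_add]
      refine (hP.add hQ).congr' ?_
      filter_upwards [self_mem_nhdsWithin] with s hs
      exact (laplaceSum_add hb hsum P.continuous Q.continuous hs).symm
    | monomial p a =>
      simp only [Polynomial.eval_monomial]
      exact hmono a p
  have hconst : ∀ δ : ℝ, Tendsto (laplaceSum b α fun _ => δ) (𝓝[>] 0) (𝓝 (K * δ)) := fun δ => by
    simpa using tendsto_laplaceSum_const_mul_pow hlim δ 0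
  have hconst' : ∀ δ : ℝ, K / Real.Gamma α * gammaIntegral α (fun _ => δ) = K * δ := fun δ => by
    have := gammaIntegral_const_mul_pow hα δ 0
    simp only [pow_zero, mul_one, Nat.cast_zero, zero_add, div_one, Real.one_rpow, one_mul] at this
    rw [this]
    field_simp
  have hK : 0 ≤ K := by
    refine ge_of_tendsto hlim ?_
    filter_upwards [self_mem_nhdsWithin] with s hs
    have hs' : (0 : ℝ) < s := hs
    exact mul_nonneg (by positivity) (tsum_nonneg fun n => mul_nonneg (hb n) (by positivity))
  refine tendsto_of_forall_approx fun ε hε => ?_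
  -- Dividing by K + 1 rather than K allows K = 0 and makes Kδ < ε strict, so that the transform of
  -- the constant δ is eventually below ε.
  set δ := ε / (K + 1) with hδ
  have hδ0 : 0 < δ := by positivity
  have hKδ : K * δ < ε := by
    rw [hδ, mul_div_assoc', div_lt_iff₀ (by positivity)]
    nlinarith
  obtain ⟨P, hP⟩ := exists_polynomial_near_of_continuousOn 0 1 φ hφ.continuousOn δ hδ0
  have hup : ∀ x ∈ Icc (0 : ℝ) 1, φ x ≤ P.eval x + δ := fun x hx => by
    have := (abs_lt.mp (hP x hx)).1
    linarith
  have hlo : ∀ x ∈ Icc (0 : ℝ) 1, P.eval x ≤ φ x + δ := fun x hx => by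
    have := (abs_lt.mp (hP x hx)).2
    linarith
  have hc1 : Continuous fun x => P.eval x + δ := P.continuous.add continuous_const
  have hc2 : Continuous fun x => φ x + δ := hφ.add continuous_const
  refine ⟨_, _, hpoly P, ?_, ?_⟩
  · filter_upwards [self_mem_nhdsWithin, (hconst δ).eventually (gt_mem_nhds hKδ)] with s hs hs'
    have h1 := laplaceSum_mono (α := α) hb hsum hφ hc1 hup hs
    have h2 := laplaceSum_mono (α := α) hb hsum P.continuous hc2 hlo hs
    rw [laplaceSum_add hb hsum P.continuous continuous_const hs] at h1
    rw [laplaceSum_add hb hsum hφ continuous_const hs] at h2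
    rw [abs_le]
    constructor <;> linarith
  · have hnn : 0 ≤ K / Real.Gamma α := div_nonneg hK (Real.Gamma_pos_of_pos hα).le
    have h1 := mul_le_mul_of_nonneg_left
      (gammaIntegral_mono hα hφ hc1 hup) hnn
    have h2 := mul_le_mul_of_nonneg_left
      (gammaIntegral_mono hα P.continuous hc2 hlo) hnn
    rw [gammaIntegral_add hα P.continuous continuous_const, mul_add, hconst'] at h1
    rw [gammaIntegral_add hα hφ continuous_const, mul_add, hconst'] at h2
    rw [abs_le]
    constructor <;> linarith

/-- A continuous function that is positive exactly on `(e ^ (-d), e ^ (-c))`. -/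
noncomputable def expBump (c d x : ℝ) : ℝ := max 0 ((x - Real.exp (-d)) * (Real.exp (-c) - x))

theorem continuous_expBump (c d : ℝ) : Continuous (expBump c d) := by
  unfold expBump
  fun_prop

theorem expBump_nonneg (c d x : ℝ) : 0 ≤ expBump c d x := le_max_left _ _

theorem expBump_pos {c d u : ℝ} (hu : u ∈ Ioo c d) : 0 < expBump c d (Real.exp (-u)) := by
  refine lt_max_of_lt_right (mul_pos ?_ ?_)
  · rw [sub_pos, Real.exp_lt_exp]
    linarith [hu.2]
  · rw [sub_pos, Real.exp_lt_exp]
    linarith [hu.1]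

theorem expBump_eq_zero {c d u : ℝ} (hcd : c ≤ d) (hu : u ∉ Ioo c d) :
    expBump c d (Real.exp (-u)) = 0 := by
  refine max_eq_left ?_
  rcases le_or_gt u c with h | h
  · refine mul_nonpos_of_nonneg_of_nonpos ?_ ?_
    · rw [sub_nonneg, Real.exp_le_exp]; linarith
    · rw [sub_nonpos, Real.exp_le_exp]; linarith
  · have h2 : d ≤ u := not_lt.mp fun h2 => hu ⟨h, h2⟩
    refine mul_nonpos_of_nonpos_of_nonneg ?_ ?_
    · rw [sub_nonpos, Real.exp_le_exp]; linarith
    · rw [sub_nonneg, Real.exp_le_exp]; linarith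

theorem gammaIntegral_expBump_pos (hα : 0 < α) {c d : ℝ} (hc : 0 < c) (hcd : c < d) :
    0 < gammaIntegral α (expBump c d) := by
  rw [gammaIntegral, setIntegral_pos_iff_support_of_nonneg_ae]
  · refine lt_of_lt_of_le ?_ (measure_mono (s := Ioo c d) fun u hu => ?_)
    · rw [Real.volume_Ioo]
      simpa using hcd
    · have hu0 : 0 < u := hc.trans hu.1
      refine ⟨?_, hu0⟩
      have := expBump_pos hu
      rw [Function.mem_support]
      positivity
  · filter_upwards [ae_restrict_mem measurableSet_Ioi] with u hu
    have hu' : (0 : ℝ) < u := hu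
    have := expBump_nonneg c d (Real.exp (-u))
    simp only [Pi.zero_apply]
    positivity
  · exact integrableOn_gammaIntegral hα (continuous_expBump c d)

theorem gammaIntegral_add_natCast_bounds (hα : 0 < α) (m : ℕ) {c d : ℝ} (hc : 0 < c) (hcd : c < d) :
    c ^ m * gammaIntegral α (expBump c d) ≤ gammaIntegral (α + m) (expBump c d) ∧
      gammaIntegral (α + m) (expBump c d) ≤ d ^ m * gammaIntegral α (expBump c d) := by
  have hi := integrableOn_gammaIntegral hα (continuous_expBump c d)
  have hi' := integrableOn_gammaIntegral (show 0 < α + m by positivity) (continuous_expBump c d)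
  have key : ∀ u ∈ Ioi (0 : ℝ),
      c ^ m * (Real.exp (-u) * u ^ (α - 1) * expBump c d (Real.exp (-u))) ≤
        Real.exp (-u) * u ^ (α + m - 1) * expBump c d (Real.exp (-u)) ∧
      Real.exp (-u) * u ^ (α + m - 1) * expBump c d (Real.exp (-u)) ≤
        d ^ m * (Real.exp (-u) * u ^ (α - 1) * expBump c d (Real.exp (-u))) := by
    intro u hu
    have hu' : (0 : ℝ) < u := hu
    by_cases h : u ∈ Ioo c d
    · have h1 := expBump_nonneg c d (Real.exp (-u))
      have e : u ^ (α + m - 1) = u ^ m * u ^ (α - 1) := by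
        rw [show α + m - 1 = m + (α - 1) by ring, Real.rpow_add hu', Real.rpow_natCast]
      rw [e]
      have h2 : c ^ m ≤ u ^ m := pow_le_pow_left₀ hc.le h.1.le m
      have h3 : u ^ m ≤ d ^ m := pow_le_pow_left₀ hu'.le h.2.le m
      have h4 : 0 ≤ Real.exp (-u) * u ^ (α - 1) * expBump c d (Real.exp (-u)) := by positivity
      have h5 := mul_le_mul_of_nonneg_right h2 h4
      have h6 := mul_le_mul_of_nonneg_right h3 h4
      constructor <;> linarith
    · rw [expBump_eq_zero hcd.le h]
      simp
  unfold gammaIntegral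
  rw [← integral_const_mul, ← integral_const_mul]
  exact ⟨setIntegral_mono_on (hi.const_mul _) hi' measurableSet_Ioi fun u hu => (key u hu).1,
    setIntegral_mono_on hi' (hi.const_mul _) measurableSet_Ioi fun u hu => (key u hu).2⟩

theorem tendsto_inv_natCast_nhdsGT : Tendsto (fun N : ℕ => (N : ℝ)⁻¹) atTop (𝓝[>] 0) :=
  tendsto_inv_atTop_nhdsGT_zero.comp tendsto_natCast_atTop_atTop

/-- Only indices in the support of φ contribute, so a bound for `f` there passes to the sums; s^m
makes up for the different exponents in the normalisations. -/
theorem laplaceSum_mul_comparison {w f : ℕ → ℝ} {a : ℝ} {φ : ℝ → ℝ} (hφ : Continuous φ)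
    (hw : ∀ n, 0 ≤ w n) (hf : ∀ n, 0 ≤ f n) (hφ0 : ∀ x, 0 ≤ φ x)
    (hs : ∀ s > 0, Summable fun n => w n * Real.exp (-s) ^ n)
    (hs' : ∀ s > 0, Summable fun n => w n * f n * Real.exp (-s) ^ n) (m : ℕ) {s : ℝ} (hspos : 0 < s) :
    ((∀ n, φ (Real.exp (-s) ^ n) ≠ 0 → a ≤ f n) →
      s ^ m * a * laplaceSum w α φ s ≤ laplaceSum (fun n => w n * f n) (α + m) φ s) ∧
    ((∀ n, φ (Real.exp (-s) ^ n) ≠ 0 → f n ≤ a) →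
      laplaceSum (fun n => w n * f n) (α + m) φ s ≤ s ^ m * a * laplaceSum w α φ s) := by
  have h1 := summable_laplaceSum hw hs hφ hspos
  have h2 := summable_laplaceSum (fun n => mul_nonneg (hw n) (hf n)) hs' hφ hspos
  have e : s ^ m * a * laplaceSum w α φ s =
      s ^ (α + m) * ∑' n, a * (w n * (φ (Real.exp (-s) ^ n) * Real.exp (-s) ^ n)) := by
    rw [laplaceSum, tsum_mul_left, Real.rpow_add hspos, Real.rpow_natCast]
    ring
  have hnn : ∀ n, 0 ≤ w n * (φ (Real.exp (-s) ^ n) * Real.exp (-s) ^ n) := fun n =>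
    mul_nonneg (hw n) (mul_nonneg (hφ0 _) (by positivity))
  rw [e, laplaceSum]
  constructor
  · intro h
    refine mul_le_mul_of_nonneg_left ((h1.mul_left a).tsum_le_tsum (fun n => ?_) h2) (by positivity)
    by_cases h0 : φ (Real.exp (-s) ^ n) = 0
    · simp [h0]
    · have := mul_le_mul_of_nonneg_right (h n h0) (hnn n)
      linarith
  · intro h
    refine mul_le_mul_of_nonneg_left (h2.tsum_le_tsum (fun n => ?_) (h1.mul_left a)) (by positivity)
    by_cases h0 : φ (Real.exp (-s) ^ n) = 0
    · simp [h0]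
    · have := mul_le_mul_of_nonneg_right (h n h0) (hnn n)
      linarith

/-- A Tauberian theorem: the power growth of a monotone sequence is read off from the Laplace
transforms of a weight and of the weighted sequence. -/
theorem tendsto_div_pow_of_laplace {w f : ℕ → ℝ} {K₀ : ℝ} (hα : 0 < α) (hK₀ : 0 < K₀) (m : ℕ)
    (hw : ∀ n, 0 ≤ w n) (hf : ∀ n, 0 ≤ f n) (hmono : Monotone f)
    (hs : ∀ s > 0, Summable fun n => w n * Real.exp (-s) ^ n)
    (hs' : ∀ s > 0, Summable fun n => w n * f n * Real.exp (-s) ^ n)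
    (h0 : Tendsto (fun s : ℝ => s ^ α * ∑' n, w n * Real.exp (-s) ^ n) (𝓝[>] 0) (𝓝 K₀))
    (h1 : Tendsto (fun s : ℝ => s ^ (α + m) * ∑' n, w n * f n * Real.exp (-s) ^ n) (𝓝[>] 0)
      (𝓝 K)) :
    Tendsto (fun N : ℕ => f N / (N : ℝ) ^ m) atTop
      (𝓝 (K / Real.Gamma (α + m) / (K₀ / Real.Gamma α))) := by
  have hαm : 0 < α + m := by positivity
  have hΓ := Real.Gamma_pos_of_pos hα
  have hΓ' := Real.Gamma_pos_of_pos hαm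
  have hwf : ∀ n, 0 ≤ w n * f n := fun n => mul_nonneg (hw n) (hf n)
  have hK : 0 ≤ K := by
    refine ge_of_tendsto h1 ?_
    filter_upwards [self_mem_nhdsWithin] with s hs
    have hs' : (0 : ℝ) < s := hs
    exact mul_nonneg (by positivity) (tsum_nonneg fun n => mul_nonneg (hwf n) (by positivity))
  set R := K / Real.Gamma (α + m) / (K₀ / Real.Gamma α) with hR
  have hR0 : 0 ≤ R := by positivity
  -- The quotient is, up to N^m, the average of `f` over n/N in (c, d), with bump weights. Its limit
  -- is pinned between c^m R and d^m R, as u^m lies between c^m and d^m on the support.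
  have ratio : ∀ c d : ℝ, 0 < c → c < d → ∃ ρ, c ^ m * R ≤ ρ ∧ ρ ≤ d ^ m * R ∧
      (∀ᶠ N : ℕ in atTop, 0 < laplaceSum w α (expBump c d) (N : ℝ)⁻¹) ∧
      Tendsto (fun N : ℕ => laplaceSum (fun n => w n * f n) (α + m) (expBump c d) (N : ℝ)⁻¹ /
        laplaceSum w α (expBump c d) (N : ℝ)⁻¹) atTop (𝓝 ρ) := by
    intro c d hc hcd
    have hI := gammaIntegral_expBump_pos hα hc hcd
    obtain ⟨b1, b2⟩ := gammaIntegral_add_natCast_bounds hα m hc hcd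
    have t0 := (tendsto_laplaceSum hα hw hs h0 (continuous_expBump c d)).comp
      tendsto_inv_natCast_nhdsGT
    have t1 := (tendsto_laplaceSum hαm hwf hs' h1 (continuous_expBump c d)).comp
      tendsto_inv_natCast_nhdsGT
    have hpos : 0 < K₀ / Real.Gamma α * gammaIntegral α (expBump c d) := by positivity
    have e : ∀ x : ℝ, x ^ m * R = K / Real.Gamma (α + m) *
        (x ^ m * gammaIntegral α (expBump c d)) /
          (K₀ / Real.Gamma α * gammaIntegral α (expBump c d)) := fun x => by
      rw [hR]
      field_simp
    refine ⟨_, ?_, ?_, t0.eventually (lt_mem_nhds hpos), t1.div t0 hpos.ne'⟩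
    · rw [e]
      gcongr
    · rw [e]
      gcongr
  -- The bump on (1, d) sees only indices n > N, where f N ≤ f n; hence f N / N^m is at most the
  -- average. The lower bound uses (c, 1) in the same way.
  have hupper : ∀ d : ℝ, 1 < d → ∀ x, d ^ m * R < x → ∀ᶠ N : ℕ in atTop, f N / (N : ℝ) ^ m < x := by
    intro d hd x hx
    obtain ⟨ρ, -, hρ, hev, ht⟩ := ratio 1 d one_pos hd
    filter_upwards [hev, ht.eventually (gt_mem_nhds (hρ.trans_lt hx)), eventually_gt_atTop 0]
      with N hN hlt hN0
    have hN0' : (0 : ℝ) < N := by exact_mod_cast hN0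
    refine lt_of_le_of_lt ?_ hlt
    rw [le_div_iff₀ hN]
    have h := (laplaceSum_mul_comparison (α := α) (a := f N) (continuous_expBump 1 d) hw hf
      (expBump_nonneg 1 d) hs hs' m (inv_pos.mpr hN0')).1 fun n hn => ?_
    · rw [inv_pow] at h
      rw [div_eq_inv_mul]
      exact h
    · apply hmono
      by_contra hlt'
      apply hn
      rw [← Real.exp_nat_mul, mul_neg]
      refine expBump_eq_zero hd.le fun h => ?_
      have h2 := h.1
      rw [← div_eq_mul_inv, lt_div_iff₀ hN0', one_mul] at h2
      exact hlt' (by exact_mod_cast h2.le)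
  have hlower : ∀ c : ℝ, 0 < c → c < 1 → ∀ x, x < c ^ m * R →
      ∀ᶠ N : ℕ in atTop, x < f N / (N : ℝ) ^ m := by
    intro c hc0 hc x hx
    obtain ⟨ρ, hρ, -, hev, ht⟩ := ratio c 1 hc0 hc
    filter_upwards [hev, ht.eventually (lt_mem_nhds (hx.trans_le hρ)), eventually_gt_atTop 0]
      with N hN hlt hN0
    have hN0' : (0 : ℝ) < N := by exact_mod_cast hN0
    refine lt_of_lt_of_le hlt ?_
    rw [div_le_iff₀ hN]
    have h := (laplaceSum_mul_comparison (α := α) (a := f N) (continuous_expBump c 1) hw hf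
      (expBump_nonneg c 1) hs hs' m (inv_pos.mpr hN0')).2 fun n hn => ?_
    · rw [inv_pow] at h
      rw [div_eq_inv_mul]
      exact h
    · apply hmono
      by_contra hlt'
      apply hn
      rw [← Real.exp_nat_mul, mul_neg]
      refine expBump_eq_zero hc.le fun h => ?_
      have h2 := h.2
      rw [← div_eq_mul_inv, div_lt_iff₀ hN0', one_mul] at h2
      exact hlt' (by exact_mod_cast h2.le)
  have hcont : Tendsto (fun x : ℝ => x ^ m * R) (𝓝 1) (𝓝 R) := by
    have : Continuous fun x : ℝ => x ^ m * R := by fun_prop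
    simpa using this.tendsto 1
  -- Narrowing the windows, c ↑ 1 and d ↓ 1, closes the gap between c^m R and d^m R.
  refine tendsto_order.mpr ⟨fun x hx => ?_, fun x hx => ?_⟩
  · have h2 : ∀ᶠ c in 𝓝[<] (1 : ℝ), x < c ^ m * R :=
      (hcont.mono_left nhdsWithin_le_nhds).eventually (lt_mem_nhds hx)
    obtain ⟨c, hc, hc'⟩ := (h2.and (Ioo_mem_nhdsLT (zero_lt_one' ℝ))).exists
    exact hlower c hc'.1 hc'.2 x hc
  · have h2 : ∀ᶠ d in 𝓝[>] (1 : ℝ), d ^ m * R < x :=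
      (hcont.mono_left nhdsWithin_le_nhds).eventually (gt_mem_nhds hx)
    obtain ⟨d, hd, hd'⟩ := (h2.and self_mem_nhdsWithin).exists
    exact hupper d hd' x hd

end Karamata

/-! ### Limits of the moments and their decay -/

section MomentLimit

/-- The limit of the `m`-th moment of the normalised size of the largest component. -/
noncomputable def momentLimit (m : ℕ) : ℝ :=
  Real.sqrt Real.pi / (2 * Real.Gamma ((m : ℝ) + 1 / 2)) * ∫ u in Ioi (0 : ℝ), momentIntegrand m u

theorem tendsto_momentSeq_div_pow {m : ℕ} (hm : 1 ≤ m) :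
    Tendsto (fun N : ℕ => momentSeq m N / (N : ℝ) ^ m) atTop (𝓝 (momentLimit m)) := by
  have hw : ∀ n, 0 ≤ expCoeff weight n := fun n => (expCoeff_weight_pos n).le
  have h0 : Tendsto (fun s : ℝ => s ^ (1 / 2 : ℝ) * ∑' n, expCoeff weight n * Real.exp (-s) ^ n)
      (𝓝[>] 0) (𝓝 (Real.exp (1 / 2))) := by
    refine tendsto_squareGenFun.congr' ?_
    filter_upwards [self_mem_nhdsWithin] with s hs
    rw [(hasSum_expCoeff_weight hs).tsum_eq]
  have hs' : ∀ s > 0, Summable fun n => expCoeff weight n * momentSeq m n * Real.exp (-s) ^ n := by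
    intro s hs
    refine Summable.of_nonneg_of_le (fun n => ?_) (fun n => ?_)
      (summable_pow_mul_geometric_of_norm_lt_one m (r := Real.exp (-s)) (abs_exp_neg_lt_one hs))
    · exact mul_nonneg (mul_nonneg (hw n) (momentSeq_nonneg m n)) (by positivity)
    · refine mul_le_mul_of_nonneg_right ?_ (by positivity)
      exact (mul_le_of_le_one_left (momentSeq_nonneg m n)
        (expCoeff_le_one weight_nonneg weight_le_one n)).trans (momentSeq_le hm n)
  have h := tendsto_div_pow_of_laplace (by norm_num) (Real.exp_pos _) m hw (momentSeq_nonneg m)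
    (momentSeq_monotone m) (fun s hs => (hasSum_expCoeff_weight hs).summable) hs' h0
    (tendsto_laplace_momentSeq hm)
  convert h using 2
  rw [momentLimit, Real.Gamma_one_half_eq, add_comm (m : ℝ)]
  have h1 := (Real.Gamma_pos_of_pos (show (0 : ℝ) < 1 / 2 + m by positivity)).ne'
  have h2 := (Real.exp_pos (1 / 2)).ne'
  field_simp

/-- Log-convexity of Γ at the midpoint x of x - 1/2 and x + 1/2, combined with the functional
equation. -/
theorem Gamma_div_Gamma_add_half_le {x : ℝ} (hx : 1 / 2 < x) :
    Real.Gamma x / Real.Gamma (x + 1 / 2) ≤ 1 / Real.sqrt (x - 1 / 2) := by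
  have hx' : 0 < x - 1 / 2 := by linarith
  have h1 := Real.Gamma_mul_add_mul_le_rpow_Gamma_mul_rpow_Gamma (s := x - 1 / 2) (t := x + 1 / 2)
    (a := 1 / 2) (b := 1 / 2) hx' (by linarith) (by norm_num) (by norm_num) (by norm_num)
  rw [show 1 / 2 * (x - 1 / 2) + 1 / 2 * (x + 1 / 2) = x by ring, ← Real.sqrt_eq_rpow,
    ← Real.sqrt_eq_rpow] at h1
  have hG := Real.Gamma_pos_of_pos (show 0 < x + 1 / 2 by linarith)
  have hG' := Real.Gamma_pos_of_pos hx'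
  have h2 : Real.Gamma (x + 1 / 2) = (x - 1 / 2) * Real.Gamma (x - 1 / 2) := by
    rw [← Real.Gamma_add_one hx'.ne']
    ring_nf
  have hs := Real.sqrt_pos.mpr hx'
  rw [div_le_div_iff₀ hG hs, one_mul]
  calc Real.Gamma x * √(x - 1 / 2)
      ≤ √(Real.Gamma (x - 1 / 2)) * √(Real.Gamma (x + 1 / 2)) * √(x - 1 / 2) := by gcongr
    _ = √((x - 1 / 2) * Real.Gamma (x - 1 / 2)) * √(Real.Gamma (x + 1 / 2)) := by
        rw [Real.sqrt_mul hx'.le]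
        ring
    _ = Real.Gamma (x + 1 / 2) := by rw [← h2, Real.mul_self_sqrt hG.le]

/-- Discarding the factor exp(-E₁/2) ≤ 1 leaves Γ(m)/Γ(m+1/2), of order m^{-1/2}. The decay of the
moments is what excludes an atom at 1. -/
theorem tendsto_momentLimit : Tendsto momentLimit atTop (𝓝 0) := by
  have h1 : Tendsto (fun m : ℕ => √Real.pi / 2 * (1 / √((m : ℝ) - 1 / 2))) atTop (𝓝 0) := by
    have h2 : Tendsto (fun m : ℕ => √((m : ℝ) - 1 / 2)) atTop atTop :=
      Real.tendsto_sqrt_atTop.comp (tendsto_atTop_add_const_right _ _ tendsto_natCast_atTop_atTop)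
    simpa using (h2.inv_tendsto_atTop).const_mul (√Real.pi / 2)
  refine tendsto_of_tendsto_of_tendsto_of_le_of_le' tendsto_const_nhds h1 ?_ ?_
  · filter_upwards with m
    have := Real.Gamma_pos_of_pos (show (0 : ℝ) < (m : ℝ) + 1 / 2 by positivity)
    have h2 : 0 ≤ ∫ u in Ioi (0 : ℝ), momentIntegrand m u :=
      setIntegral_nonneg measurableSet_Ioi fun u hu => momentIntegrand_nonneg m hu
    unfold momentLimit
    positivity
  · filter_upwards [eventually_ge_atTop 1] with m hm
    have hm' : (1 : ℝ) ≤ m := by exact_mod_cast hm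
    have hG := Real.Gamma_pos_of_pos (show (0 : ℝ) < (m : ℝ) + 1 / 2 by positivity)
    have h2 : ∫ u in Ioi (0 : ℝ), momentIntegrand m u ≤ Real.Gamma m := by
      rw [Real.Gamma_eq_integral (by linarith)]
      refine setIntegral_mono_on (integrableOn_momentIntegrand m)
        (Real.GammaIntegral_convergent (by linarith)) measurableSet_Ioi fun u hu => ?_
      refine (momentIntegrand_le m hu).trans_eq ?_
      rw [← Real.rpow_natCast u (m - 1), Nat.cast_sub hm, Nat.cast_one]
    calc momentLimit m ≤ √Real.pi / (2 * Real.Gamma ((m : ℝ) + 1 / 2)) * Real.Gamma m := by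
          unfold momentLimit
          gcongr
      _ = √Real.pi / 2 * (Real.Gamma m / Real.Gamma ((m : ℝ) + 1 / 2)) := by field_simp
      _ ≤ _ := mul_le_mul_of_nonneg_left (Gamma_div_Gamma_add_half_le (by linarith)) (by positivity)

end MomentLimit

/-! ### The law of the largest component under the uniform measure -/

section Law

theorem magicalSquares_nonempty (n : ℕ) : (magicalSquares n 2).Nonempty :=
  ⟨Matrix.diagonal fun _ => 2, fun i => by simp [Matrix.diagonal_apply],
    fun j => by simp [Matrix.diagonal_apply]⟩

instance isProbabilityMeasure_uniformOn_magicalSquares (n : ℕ) :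
    IsProbabilityMeasure (uniformOn (magicalSquares n 2)) :=
  isProbabilityMeasure_uniformOn' (finite_magicalSquares n) (magicalSquares_nonempty n)
    MeasurableSpace.measurableSet_top

theorem uniformOn_largestComponent_le (n k : ℕ) :
    (uniformOn (magicalSquares n 2)).real {A | largestComponent 2 A ≤ k} =
      expCoeff (weightUpTo k) n / expCoeff weight n := by
  have hfin := finite_magicalSquares n
  have hmeas : ∀ s : Set (Matrix (Fin n) (Fin n) ℕ), MeasurableSet s := fun s =>
    MeasurableSpace.measurableSet_top
  have hc : ∀ s : Set (Matrix (Fin n) (Fin n) ℕ), s.Finite → (Measure.count s).toReal = s.ncard := by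
    intro s hs
    rw [Measure.count_apply (hmeas s), ← hs.cast_ncard_eq]
    simp
  rw [Measure.real, uniformOn, cond_apply (hmeas _), ENNReal.toReal_mul, ENNReal.toReal_inv,
    hc _ hfin, hc _ (hfin.inter_of_left _), ncard_magicalSquares, ncard_largestComponent_le]
  have := (expCoeff_weight_pos n).ne'
  field_simp

theorem measurable_of_matrix {n : ℕ} {β : Type*} [MeasurableSpace β]
    (f : Matrix (Fin n) (Fin n) ℕ → β) : Measurable f := fun _ _ =>
  MeasurableSpace.measurableSet_top

theorem integral_largestComponent_pow {m : ℕ} (hm : 1 ≤ m) (n : ℕ) :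
    ∫ A, (largestComponent 2 A : ℝ) ^ m ∂(uniformOn (magicalSquares n 2)) = momentSeq m n := by
  -- L^m telescopes into the increments (k+1)^m - k^m over k < L, and 0^m = 0 because m ≥ 1.
  have hpt : ∀ A : Matrix (Fin n) (Fin n) ℕ, (largestComponent 2 A : ℝ) ^ m =
      ∑ k ∈ Finset.range n, (((k : ℝ) + 1) ^ m - (k : ℝ) ^ m) *
        ({A | largestComponent 2 A ≤ k}ᶜ : Set (Matrix (Fin n) (Fin n) ℕ)).indicator 1 A := by
    intro A
    have h := Finset.sum_range_sub (fun k : ℕ => (k : ℝ) ^ m) (largestComponent 2 A)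
    have h0 : m ≠ 0 := by omega
    simp only [Nat.cast_zero, zero_pow h0, sub_zero, Nat.cast_succ] at h
    rw [← h]
    rw [← Finset.sum_subset (Finset.range_subset_range.mpr (largestComponent_le (r := 2) A))]
    · refine Finset.sum_congr rfl fun k hk => ?_
      rw [Set.indicator_of_mem (by simpa using hk)]
      simp
    · intro k _ hk
      rw [Set.indicator_of_notMem (by simpa using hk), mul_zero]
  simp_rw [hpt]
  rw [integral_finsetSum]
  · refine Finset.sum_congr rfl fun k _ => ?_
    rw [integral_const_mul, integral_indicator_one MeasurableSpace.measurableSet_top,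
      probReal_compl_eq_one_sub MeasurableSpace.measurableSet_top, uniformOn_largestComponent_le]
  · intro k _
    refine Integrable.const_mul ?_ _
    exact (integrable_indicator_iff MeasurableSpace.measurableSet_top).mpr
      (integrableOn_const (measure_ne_top _ _))

theorem largestComponent_div_mem_Icc {n : ℕ} (A : Matrix (Fin n) (Fin n) ℕ) :
    (largestComponent 2 A : ℝ) / n ∈ Icc (0 : ℝ) 1 :=
  ⟨by positivity, div_le_one_of_le₀ (by exact_mod_cast largestComponent_le A) (by positivity)⟩

/-- The law of the normalised size of the largest component, on the unit interval. -/
noncomputable def normalizedLaw (n : ℕ) : ProbabilityMeasure (Icc (0 : ℝ) 1) :=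
  ⟨(uniformOn (magicalSquares n 2)).map fun A => ⟨_, largestComponent_div_mem_Icc A⟩,
    Measure.isProbabilityMeasure_map (measurable_of_matrix _).aemeasurable⟩

theorem integral_normalizedLaw (n : ℕ) {f : Icc (0 : ℝ) 1 → ℝ} (hf : Continuous f) :
    ∫ x, f x ∂(normalizedLaw n : Measure (Icc (0 : ℝ) 1)) =
      ∫ A, f ⟨_, largestComponent_div_mem_Icc A⟩ ∂(uniformOn (magicalSquares n 2)) :=
  integral_map (measurable_of_matrix _).aemeasurable hf.aestronglyMeasurable

theorem integral_pow_normalizedLaw {m : ℕ} (hm : 1 ≤ m) (n : ℕ) :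
    ∫ x, (x : ℝ) ^ m ∂(normalizedLaw n : Measure (Icc (0 : ℝ) 1)) = momentSeq m n / (n : ℝ) ^ m := by
  rw [integral_normalizedLaw n (by fun_prop)]
  simp only [div_pow]
  rw [integral_div, integral_largestComponent_pow hm]

theorem normalizedLaw_lt_le {n : ℕ} (hn : 0 < n) {ε : ℝ} (hε : 0 ≤ ε) (hε' : ε ≤ 1 / 2) :
    (normalizedLaw n : Measure (Icc (0 : ℝ) 1)) {x | (x : ℝ) < ε} ≤ ENNReal.ofReal (2 * ε) := by
  have hn' : (0 : ℝ) < n := by exact_mod_cast hn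
  have hms : MeasurableSet {x : Icc (0 : ℝ) 1 | (x : ℝ) < ε} :=
    (isOpen_lt continuous_subtype_val continuous_const).measurableSet
  have h0 : 0 ≤ ε * n := by positivity
  have h1 := Nat.floor_le h0
  refine (Measure.map_apply (measurable_of_matrix _) hms).trans_le ?_
  refine (measure_mono (t := {A | largestComponent 2 A ≤ ⌊ε * n⌋₊}) fun A hA => ?_).trans ?_
  · have hA' : (largestComponent 2 A : ℝ) / n < ε := hA
    rw [div_lt_iff₀ hn'] at hA'
    exact Nat.le_floor hA'.le
  · rw [← ENNReal.ofReal_toReal (measure_ne_top (uniformOn (magicalSquares n 2)) _)]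
    refine ENNReal.ofReal_le_ofReal ?_
    refine (uniformOn_largestComponent_le n _).trans_le ?_
    refine (expCoeff_ratio_le hn ?_).trans ?_
    · have : (2 * ⌊ε * n⌋₊ : ℝ) ≤ n := by nlinarith
      exact_mod_cast this
    · rw [div_le_iff₀ hn']
      linarith

end Law

/-! ### Convergence by moments, uniqueness and existence of the limit law -/

section WeakLimit

theorem integrable_polynomial_eval {μ : Measure ℝ} [IsProbabilityMeasure μ]
    (hμ : ∀ᵐ x ∂μ, x ∈ Icc (0 : ℝ) 1) (P : Polynomial ℝ) :
    Integrable (fun x => P.eval x) μ := by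
  obtain ⟨M, hM⟩ := exists_bound_Icc P.continuous
  refine Integrable.of_bound P.continuous.aestronglyMeasurable M ?_
  filter_upwards [hμ] with x hx using hM x hx

/-- All the measures live on [0,1], where polynomials approximate a bounded continuous function
uniformly, with an error independent of the measure. The zeroth moment needs no hypothesis, as the
total mass is 1. -/
theorem tendsto_of_tendsto_moments {ι : Type*} {l : Filter ι} {ν : ι → ProbabilityMeasure ℝ}
    {μ : ProbabilityMeasure ℝ} (hν : ∀ i, ∀ᵐ x ∂(ν i : Measure ℝ), x ∈ Icc (0 : ℝ) 1)
    (hμ : ∀ᵐ x ∂(μ : Measure ℝ), x ∈ Icc (0 : ℝ) 1)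
    (h : ∀ m : ℕ, 1 ≤ m → Tendsto (fun i => ∫ x, x ^ m ∂(ν i : Measure ℝ)) l
      (𝓝 (∫ x, x ^ m ∂(μ : Measure ℝ)))) : Tendsto ν l (𝓝 μ) := by
  have hpoly : ∀ P : Polynomial ℝ, Tendsto (fun i => ∫ x, P.eval x ∂(ν i : Measure ℝ)) l
      (𝓝 (∫ x, P.eval x ∂(μ : Measure ℝ))) := by
    intro P
    induction P using Polynomial.induction_on' with
    | add P Q hP hQ =>
      simp only [Polynomial.eval_add]
      rw [integral_add (integrable_polynomial_eval hμ P) (integrable_polynomial_eval hμ Q)]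
      refine (hP.add hQ).congr fun i => ?_
      rw [integral_add (integrable_polynomial_eval (hν i) P) (integrable_polynomial_eval (hν i) Q)]
    | monomial p a =>
      simp only [Polynomial.eval_monomial, integral_const_mul]
      rcases Nat.eq_zero_or_pos p with rfl | hp
      · simpa using tendsto_const_nhds
      · exact (h p hp).const_mul a
  rw [ProbabilityMeasure.tendsto_iff_forall_integral_tendsto]
  intro f
  refine tendsto_of_forall_approx fun ε hε => ?_
  obtain ⟨P, hP⟩ := exists_polynomial_near_of_continuousOn 0 1 f f.continuous.continuousOn ε hε
  have key : ∀ κ : ProbabilityMeasure ℝ, (∀ᵐ x ∂(κ : Measure ℝ), x ∈ Icc (0 : ℝ) 1) →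
      |∫ x, f x ∂(κ : Measure ℝ) - ∫ x, P.eval x ∂(κ : Measure ℝ)| ≤ ε := by
    intro κ hκ
    rw [← integral_sub (f.integrable _) (integrable_polynomial_eval hκ P)]
    have := norm_integral_le_of_norm_le_const (μ := (κ : Measure ℝ))
      (f := fun x => f x - P.eval x) (C := ε) (by
        filter_upwards [hκ] with x hx
        rw [Real.norm_eq_abs, abs_sub_comm]
        exact (hP x hx).le)
    simpa using this
  exact ⟨_, _, hpoly P, Eventually.of_forall fun i => key _ (hν i), key μ hμ⟩

theorem IsLargestComponentLaw.ae_mem_Ioo {μ : ProbabilityMeasure ℝ} (h : IsLargestComponentLaw μ) :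
    ∀ᵐ x ∂(μ : Measure ℝ), x ∈ Ioo (0 : ℝ) 1 :=
  (mem_ae_iff_prob_eq_one measurableSet_Ioo).mpr h.1

theorem IsLargestComponentLaw.integral_pow {μ : ProbabilityMeasure ℝ} (h : IsLargestComponentLaw μ)
    {m : ℕ} (hm : 1 ≤ m) : ∫ x, x ^ m ∂(μ : Measure ℝ) = momentLimit m := by
  rw [momentLimit, ← h.2 m hm, Measure.restrict_eq_self_of_ae_mem h.ae_mem_Ioo]

/-- By the moment criterion the constant sequence μ converges to ν, and limits are unique. -/
theorem IsLargestComponentLaw.unique {μ ν : ProbabilityMeasure ℝ} (hμ : IsLargestComponentLaw μ)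
    (hν : IsLargestComponentLaw ν) : μ = ν := by
  have h : Tendsto (fun _ : ℕ => μ) atTop (𝓝 ν) := by
    refine tendsto_of_tendsto_moments (fun _ => hμ.ae_mem_Ioo.mono fun x hx => Ioo_subset_Icc_self hx)
      (hν.ae_mem_Ioo.mono fun x hx => Ioo_subset_Icc_self hx) fun m hm => ?_
    rw [hμ.integral_pow hm, hν.integral_pow hm]
    exact tendsto_const_nhds
  exact tendsto_nhds_unique tendsto_const_nhds h

/-- Working on the compact interval gives a limit along an ultrafilter without a tightness argument;
excluding atoms at the two endpoints then puts the measure on the open interval. -/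
theorem exists_isLargestComponentLaw : ∃ μ : ProbabilityMeasure ℝ, IsLargestComponentLaw μ := by
  set U : Ultrafilter ℕ := hyperfilter ℕ with hU
  have hle : (U : Filter ℕ) ≤ atTop := Nat.hyperfilter_le_atTop
  obtain ⟨lam, -, hlam⟩ := isCompact_univ.ultrafilter_le_nhds (U.map normalizedLaw) (by simp)
  have ht : Tendsto normalizedLaw U (𝓝 lam) := hlam
  have hmom : ∀ m : ℕ, 1 ≤ m → ∫ x, (x : ℝ) ^ m ∂(lam : Measure (Icc (0 : ℝ) 1)) = momentLimit m := by
    intro m hm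
    have h1 := ProbabilityMeasure.tendsto_iff_forall_integral_tendsto.mp ht
      (BoundedContinuousFunction.mkOfCompact ⟨fun x : Icc (0 : ℝ) 1 => (x : ℝ) ^ m, by fun_prop⟩)
    simp only [BoundedContinuousFunction.mkOfCompact_apply, ContinuousMap.coe_mk,
      integral_pow_normalizedLaw hm] at h1
    exact tendsto_nhds_unique h1 ((tendsto_momentSeq_div_pow hm).mono_left hle)
  -- The portmanteau inequality for the open sets {x < ε} carries the uniform bound 2ε to the limit.
  have hzero : (lam : Measure (Icc (0 : ℝ) 1)) {x | (x : ℝ) = 0} = 0 := by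
    have hbd : ∀ ε : ℝ, 0 < ε → ε ≤ 1 / 2 →
        (lam : Measure (Icc (0 : ℝ) 1)) {x | (x : ℝ) = 0} ≤ ENNReal.ofReal (2 * ε) := by
      intro ε hε hε'
      have hop : IsOpen {x : Icc (0 : ℝ) 1 | (x : ℝ) < ε} :=
        isOpen_lt continuous_subtype_val continuous_const
      refine (measure_mono (t := {x : Icc (0 : ℝ) 1 | (x : ℝ) < ε}) fun x hx => ?_).trans
        ((ProbabilityMeasure.le_liminf_measure_open_of_tendsto ht hop).trans ?_)
      · have hx' : (x : ℝ) = 0 := hx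
        exact hx'.trans_lt hε
      · refine liminf_le_of_frequently_le' (Eventually.frequently (hle ?_))
        filter_upwards [eventually_gt_atTop 0] with n hn using normalizedLaw_lt_le hn hε.le hε'
    have hlim : Tendsto (fun ε : ℝ => ENNReal.ofReal (2 * ε)) (𝓝[>] 0) (𝓝 0) := by
      have : Continuous fun ε : ℝ => ENNReal.ofReal (2 * ε) :=
        ENNReal.continuous_ofReal.comp (continuous_const.mul continuous_id)
      simpa using (this.tendsto 0).mono_left (nhdsWithin_le_nhds (s := Ioi 0))
    refine le_antisymm (ge_of_tendsto hlim ?_) bot_le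
    filter_upwards [Ioo_mem_nhdsGT (show (0 : ℝ) < 1 / 2 by norm_num)] with ε hε
    exact hbd ε hε.1 hε.2.le
  have hone : (lam : Measure (Icc (0 : ℝ) 1)) {x | (x : ℝ) = 1} = 0 := by
    have hms : MeasurableSet {x : Icc (0 : ℝ) 1 | (x : ℝ) = 1} :=
      (isClosed_eq continuous_subtype_val continuous_const).measurableSet
    -- The indicator of {1} lies below x^m on [0,1], so an atom at 1 would bound all moments from
    -- below.
    have hbd : ∀ m : ℕ, 1 ≤ m →
        (lam : Measure (Icc (0 : ℝ) 1)).real {x | (x : ℝ) = 1} ≤ momentLimit m := by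
      intro m hm
      rw [← hmom m hm, ← integral_indicator_one hms]
      refine integral_mono_of_nonneg (Eventually.of_forall fun x => ?_) ?_
        (Eventually.of_forall fun x => ?_)
      · exact Set.indicator_nonneg (fun _ _ => zero_le_one) x
      · exact (BoundedContinuousFunction.mkOfCompact
          ⟨fun x : Icc (0 : ℝ) 1 => (x : ℝ) ^ m, by fun_prop⟩).integrable _
      · by_cases hx : (x : ℝ) = 1
        · rw [Set.indicator_of_mem (by exact hx)]
          simp [hx]
        · rw [Set.indicator_of_notMem (by exact hx)]
          exact pow_nonneg x.2.1 m
    have h1 : (lam : Measure (Icc (0 : ℝ) 1)).real {x | (x : ℝ) = 1} ≤ 0 := by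
      refine ge_of_tendsto tendsto_momentLimit ?_
      filter_upwards [eventually_ge_atTop 1] with m hm using hbd m hm
    exact (measureReal_eq_zero_iff).mp (le_antisymm h1 measureReal_nonneg)
  let μ : ProbabilityMeasure ℝ := lam.map (f := Subtype.val) measurable_subtype_coe.aemeasurable
  have hμ : (μ : Measure ℝ) = (lam : Measure (Icc (0 : ℝ) 1)).map Subtype.val := rfl
  have hae : ∀ᵐ x ∂(μ : Measure ℝ), x ∈ Ioo (0 : ℝ) 1 := by
    rw [hμ]
    refine (ae_map_iff measurable_subtype_coe.aemeasurable measurableSet_Ioo).mpr ?_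
    have h0 : ∀ᵐ x : Icc (0 : ℝ) 1 ∂(lam : Measure (Icc (0 : ℝ) 1)), (x : ℝ) ≠ 0 := by
      rw [ae_iff]
      simpa using hzero
    have h1 : ∀ᵐ x : Icc (0 : ℝ) 1 ∂(lam : Measure (Icc (0 : ℝ) 1)), (x : ℝ) ≠ 1 := by
      rw [ae_iff]
      simpa using hone
    filter_upwards [h0, h1] with x hx0 hx1
    exact ⟨lt_of_le_of_ne x.2.1 hx0.symm, lt_of_le_of_ne x.2.2 hx1⟩
  refine ⟨μ, (mem_ae_iff_prob_eq_one measurableSet_Ioo).mp hae, fun m hm => ?_⟩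
  rw [Measure.restrict_eq_self_of_ae_mem hae, hμ,
    integral_map measurable_subtype_coe.aemeasurable (by fun_prop), hmom m hm, momentLimit]

end WeakLimit

/-! ### The main theorem -/

theorem mainTheorem4 :
    (∀ m : ℕ, 1 ≤ m → IntegrableOn (momentIntegrand m) (Ioi 0)) ∧
    ∃ 𝓛 : ProbabilityMeasure ℝ,
      IsLargestComponentLaw 𝓛 ∧
      (∀ 𝓜 : ProbabilityMeasure ℝ, IsLargestComponentLaw 𝓜 → 𝓜 = 𝓛) ∧
      ∀ (Ω : ℕ → Type*) [∀ n, MeasurableSpace (Ω n)] (P : (n : ℕ) → Measure (Ω n))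
        [∀ n, IsProbabilityMeasure (P n)]
        (A : (n : ℕ) → Ω n → Matrix (Fin n) (Fin n) ℕ),
        (∀ n, HasLaw (A n) (uniformOn (magicalSquares n 2)) (P n)) →
        TendstoInDistribution
          (fun (n : ℕ) (ω : Ω n) => (largestComponent 2 (A n ω) : ℝ) / (n : ℝ))
          atTop (fun x : ℝ => x) P (𝓛 : Measure ℝ) := by
  refine ⟨fun m _ => integrableOn_momentIntegrand m, ?_⟩
  obtain ⟨𝓛, h𝓛⟩ := exists_isLargestComponentLaw
  refine ⟨𝓛, h𝓛, fun 𝓜 h𝓜 => h𝓜.unique h𝓛, ?_⟩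
  intro Ω _ P _ A hA
  have hae : ∀ n, AEMeasurable (fun ω : Ω n => (largestComponent 2 (A n ω) : ℝ) / (n : ℝ)) (P n) :=
    fun n => (measurable_of_matrix fun B : Matrix (Fin n) (Fin n) ℕ =>
      (largestComponent 2 B : ℝ) / (n : ℝ)).comp_aemeasurable (hA n).aemeasurable
  refine ⟨hae, by fun_prop, ?_⟩
  have hid : (⟨(𝓛 : Measure ℝ).map (fun x : ℝ => x), Measure.isProbabilityMeasure_map (by fun_prop)⟩ :
      ProbabilityMeasure ℝ) = 𝓛 := Subtype.ext Measure.map_id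
  rw [hid]
  refine tendsto_of_tendsto_moments (fun n => ?_)
    (h𝓛.ae_mem_Ioo.mono fun x hx => Ioo_subset_Icc_self hx) fun m hm => ?_
  · refine (ae_map_iff (hae n) measurableSet_Icc).mpr (Eventually.of_forall fun ω => ?_)
    exact largestComponent_div_mem_Icc (A n ω)
  · rw [h𝓛.integral_pow hm]
    refine (tendsto_momentSeq_div_pow hm).congr fun n => ?_
    refine Eq.trans ?_ (integral_map (hae n) (f := fun x : ℝ => x ^ m) (by fun_prop)).symm
    rw [← integral_largestComponent_pow hm, ← (hA n).map_eq, integral_map (hA n).aemeasurable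
      (measurable_of_matrix _).aestronglyMeasurable, ← integral_div]
    simp only [div_pow]
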